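/- Let $\mathcal K$ be an algebraic number field with ring of integers $\mathcal O$, let $\mathcal O^*$ be the group of units of $\mathcal O$ and $\mathcal O^\times=\mathcal O\setminus\{0\}$. Let $$P_{\mathcal O}=\left\{\begin{pmatrix}1&y\\0&x\end{pmatrix}: y\in\mathcal O,\ x\in\mathcal O^*\right\}\subset P_{\mathcal K}=\left\{\begin{pmatrix}1&y\\0&x\end{pmatrix}: y\in\mathcal K,\ x\in\mathcal K^*\right\}.$$ Every double coset $P_{\mathcal O}\gamma P_{\mathcal O}$ contains finitely many right cosets $P_{\mathcal O}\gamma'$; let $R(\gamma)$ be their number. The Hecke algebra $\mathcal H(P_{\mathcal K},P_{\mathcal O})$ is the unital $*$-algebra of complex-valued $P_{\mathcal O}$-bi-invariant functions on $P_{\mathcal K}$ supported on finitely many double cosets, with product $(f*g)(\gamma)=\sum_{\gamma_1\in P_{\mathcal O}\backslash P_{\mathcal K}}f(\gamma\gamma_1^{-1})g(\gamma_1)$, involution $f^*(\gamma)=\overline{f(\gamma^{-1})}$ and unit the characteristic function of $P_{\mathcal O}$. Write $[S]$ for the characteristic function of $S$. For $a\in\mathcal O^\times$ let $N_a=|\mathcal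 O/a\mathcal O|$ and $$\mu_a=\frac1{\sqrt{N_a}}\left[P_{\mathcal O}\begin{pmatrix}1&0\\0&a\end{pmatrix}P_{\mathcal O}\right],$$ and for $r\in\mathcal K$ let $R(r)=R\begin{pmatrix}1&r\\0&1\end{pmatrix}$ and $$\theta_r=\frac1{R(r)}\left[P_{\mathcal O}\begin{pmatrix}1&r\\0&1\end{pmatrix}P_{\mathcal O}\right];$$ $R(r)$ and $\theta_r$ depend only on the class of $r$ in $\mathcal K/\mathcal O$. For $r\in\mathcal K/\mathcal O$ let $\mathcal O^*_r=\{u\in\mathcal O^*: ur=r\}$, a subgroup of finite index in $\mathcal O^*$. Then the elements $\mu_a$ $(a\in\mathcal O^\times)$ and $\theta_r$ $(r\in\mathcal K/\mathcal O)$ of $\mathcal H(P_{\mathcal K},P_{\mathcal O})$ satisfy the relations * (I.1) $\mu_w=1$ for all $w\in\mathcal O^*$; * (I.2) $\mu_a^*\mu_a=1$ for all $a\in\mathcal O^\times$; * (I.3) $\mu_a\mu_b=\mu_{ab}$ for all $a,b\in\mathcal O^\times$; * (II.1) $\theta_0=1$; * (II.2) $\theta_{wr}=\theta_r=\theta_r^*$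 for all $r\in\mathcal K/\mathcal O$ and $w\in\mathcal O^*$; * (II.3) $\displaystyle\theta_r\theta_s=\frac1{R(r)}\frac1{R(s)}\sum_{u\in\mathcal O^*/\mathcal O^*_r}\ \sum_{v\in\mathcal O^*/\mathcal O^*_s}\theta_{ur+vs}$ for all $r,s\in\mathcal K/\mathcal O$; * (III) $\displaystyle\mu_a\theta_r\mu_a^*=\frac1{N_a}\sum_{b\in\mathcal O/a\mathcal O}\theta_{\frac{r+b}{a}}$ for all $a\in\mathcal O^\times$ and $r\in\mathcal K/\mathcal O$; and $\mathcal H(P_{\mathcal K},P_{\mathcal O})$ is the universal unital $*$-algebra over $\mathbb C$ generated by elements subject to these relations: for every unital $*$-algebra $A$ over $\mathbb C$ and all families $(m_a)_{a\in\mathcal O^\times}$ and $(t_r)_{r\in\mathcal K/\mathcal O}$ in $A$ that satisfy (I.1)–(III) (with $m$, $t$ in place of $\mu$, $\theta$), there is exactly one unital $*$-homomorphism $\varphi:\mathcal H(P_{\mathcal K},P_{\mathcal O})\to A$ with $\varphi(\mu_a)=m_a$ and $\varphi(\theta_r)=t_r$ for all $a$ and $r$. Moreover, the set $\{\mu_a^*\theta_r\mu_b: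 a,b\in\mathcal O^\times,\ r\in\mathcal K/\mathcal O\}$ (a set of elements; different triples $(a,r,b)$ may give the same element) is a linear basis of $\mathcal H(P_{\mathcal K},P_{\mathcal O})$. -/

import Mathlib

open scoped nonZeroDivisors NumberField

/-! ### The Hecke algebra of a Hecke pair -/

namespace HeckePair

universe u

/-- The space `H \ G` of right cosets `H g`. -/
abbrev RightCosets {G : Type u} [Group G] (H : Subgroup G) : Type u :=
  Quotient (QuotientGroup.rightRel H)

/-- The set of right cosets contained in the double coset `H g H`. -/
def rightCosetsIn {G : Type u} [Group G] (H : Subgroup G) (g : G) : Set (RightCosets H) :=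
  Quotient.mk (QuotientGroup.rightRel H) '' DoubleCoset.doubleCoset g H H

/-- The number `R(g)` of right cosets in the double coset `H g H`. -/
noncomputable def numRightCosets {G : Type u} [Group G] (H : Subgroup G) (g : G) : ℕ :=
  (rightCosetsIn H g).ncard

/-- `(G, H)` is a Hecke pair: every double coset contains finitely many right cosets. -/
class IsHeckePair {G : Type u} [Group G] (H : Subgroup G) : Prop where
  finite_rightCosetsIn : ∀ g : G, (rightCosetsIn H g).Finite

/-- The space of complex-valued `H`-bi-invariant functions on `G` supported on finitely many
double cosets. -/
def heckeSubmodule {G : Type u} [Group G] (H : Subgroup G) : Submodule ℂ (G → ℂ) where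
  carrier := {f | (∀ h ∈ H, ∀ k ∈ H, ∀ g, f (h * g * k) = f g) ∧
    ∃ s : Set G, s.Finite ∧ Function.support f ⊆ ⋃ g ∈ s, DoubleCoset.doubleCoset g H H}
  add_mem' := by
    rintro f g ⟨hf, s, hs, hfs⟩ ⟨hg, t, ht, hgt⟩
    refine ⟨fun h hh k hk x => by simp [hf h hh k hk x, hg h hh k hk x], s ∪ t, hs.union ht, ?_⟩
    refine (Function.support_add f g).trans ?_
    rw [Set.biUnion_union]
    exact Set.union_subset_union hfs hgt
  zero_mem' := ⟨fun _ _ _ _ _ => rfl, ∅, Set.finite_empty, by simp⟩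
  smul_mem' := by
    rintro c f ⟨hf, s, hs, hfs⟩
    refine ⟨fun h hh k hk x => by simp [hf h hh k hk x], s, hs, ?_⟩
    exact (Function.support_const_smul_subset c f).trans hfs

/-- The underlying complex vector space of the Hecke algebra `ℋ(G, H)`. -/
def HeckeAlgebra {G : Type u} [Group G] (H : Subgroup G) : Type u := heckeSubmodule H

/-- Convolution: `(f * g)(γ) = ∑_{γ₁ ∈ H \ G} f (γ γ₁⁻¹) g(γ₁)`. -/
noncomputable def conv {G : Type u} [Group G] (H : Subgroup G) (f g : G → ℂ) (γ : G) : ℂ :=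
  ∑ᶠ q : RightCosets H, f (γ * q.out⁻¹) * g q.out

section Aux

variable {G : Type u} [Group G] {H : Subgroup G}

theorem exists_out_eq (γ : G) :
    ∃ h ∈ H, (Quotient.mk (QuotientGroup.rightRel H) γ).out = h * γ := by
  have h1 : (QuotientGroup.rightRel H) (Quotient.mk (QuotientGroup.rightRel H) γ).out γ :=
    Quotient.mk_out γ
  rw [QuotientGroup.rightRel_apply] at h1
  exact ⟨_, H.inv_mem h1, by group⟩

theorem apply_out {F : G → ℂ} (hF : ∀ h ∈ H, ∀ g, F (h * g) = F g) (γ : G) :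
    F (Quotient.mk (QuotientGroup.rightRel H) γ).out = F γ := by
  obtain ⟨h, hh, e⟩ := exists_out_eq (H := H) γ
  rw [e, hF h hh]

/-- Right translation on the space of right cosets. -/
def rightTranslate (H : Subgroup G) (c : G) : RightCosets H ≃ RightCosets H where
  toFun := Quotient.map (· * c) (by
    intro a b hab
    change (QuotientGroup.rightRel H) a b at hab
    change (QuotientGroup.rightRel H) (a * c) (b * c)
    rw [QuotientGroup.rightRel_apply] at hab ⊢
    simpa [mul_assoc] using hab)
  invFun := Quotient.map (· * c⁻¹) (by
    intro a b hab
    change (QuotientGroup.rightRel H) a b at hab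
    change (QuotientGroup.rightRel H) (a * c⁻¹) (b * c⁻¹)
    rw [QuotientGroup.rightRel_apply] at hab ⊢
    simpa [mul_assoc] using hab)
  left_inv := by
    rintro ⟨a⟩
    exact congrArg (Quotient.mk (QuotientGroup.rightRel H)) (mul_inv_cancel_right a c)
  right_inv := by
    rintro ⟨a⟩
    exact congrArg (Quotient.mk (QuotientGroup.rightRel H)) (inv_mul_cancel_right a c)

theorem exists_ne_zero_of_finsum {ι : Type u} {F : ι → ℂ} (h : ∑ᶠ i, F i ≠ 0) :
    ∃ i, F i ≠ 0 := by
  by_contra hc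
  push Not at hc
  exact h (by simp [hc])

theorem finsum_translate {F : G → ℂ} (hF : ∀ h ∈ H, ∀ g, F (h * g) = F g) (c : G) :
    ∑ᶠ q : RightCosets H, F (q.out * c) = ∑ᶠ q : RightCosets H, F q.out := by
  rw [← finsum_comp_equiv (rightTranslate H c) (f := fun q : RightCosets H => F q.out)]
  refine finsum_congr fun q => ?_
  induction q using Quotient.inductionOn with
  | h a =>
    obtain ⟨h, hh, e⟩ := exists_out_eq (H := H) a
    change _ = F (Quotient.mk (QuotientGroup.rightRel H) (a * c)).out
    rw [apply_out hF, e, mul_assoc, hF h hh]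

theorem left_inv_of_mem {f : G → ℂ} (hf : f ∈ heckeSubmodule H) :
    ∀ h ∈ H, ∀ g, f (h * g) = f g := fun h hh g => by
  simpa using hf.1 h hh 1 H.one_mem g

theorem right_inv_of_mem {f : G → ℂ} (hf : f ∈ heckeSubmodule H) :
    ∀ h ∈ H, ∀ g, f (g * h) = f g := fun h hh g => by
  simpa using hf.1 1 H.one_mem h hh g

theorem finite_image_support [IsHeckePair H] {f : G → ℂ} (hf : f ∈ heckeSubmodule H) :
    (Quotient.mk (QuotientGroup.rightRel H) '' Function.support f).Finite := by
  obtain ⟨-, s, hs, hfs⟩ := hf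
  refine Set.Finite.subset (hs.biUnion fun g _ => IsHeckePair.finite_rightCosetsIn (H := H) g) ?_
  rintro _ ⟨x, hx, rfl⟩
  obtain ⟨g, hg, hxg⟩ := Set.mem_iUnion₂.1 (hfs hx)
  exact Set.mem_iUnion₂.2 ⟨g, hg, x, hxg, rfl⟩

theorem finite_support_out [IsHeckePair H] {f : G → ℂ} (hf : f ∈ heckeSubmodule H) :
    (Function.support fun q : RightCosets H => f q.out).Finite := by
  refine (finite_image_support hf).subset fun q hq => ⟨q.out, hq, Quotient.out_eq q⟩

theorem conv_mem [IsHeckePair H] {f g : G → ℂ} (hf : f ∈ heckeSubmodule H)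
    (hg : g ∈ heckeSubmodule H) : conv H f g ∈ heckeSubmodule H := by
  constructor
  · intro h hh k hk γ
    have h1 : conv H f g (h * γ * k) = ∑ᶠ q : RightCosets H, f (γ * k * q.out⁻¹) * g q.out :=
      finsum_congr fun q => by
        rw [mul_assoc h, mul_assoc h, left_inv_of_mem hf h hh]
    rw [h1, ← finsum_translate (F := fun x => f (γ * k * x⁻¹) * g x) ?_ k]
    · refine finsum_congr fun q => ?_
      have : γ * k * (q.out * k)⁻¹ = γ * q.out⁻¹ := by group
      rw [this, right_inv_of_mem hg k hk]
    · intro h' hh' x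
      have : γ * k * (h' * x)⁻¹ = γ * k * x⁻¹ * h'⁻¹ := by group
      simp only [this]
      rw [right_inv_of_mem hf _ (H.inv_mem hh'), left_inv_of_mem hg _ hh']
  · refine ⟨(fun p : RightCosets H × RightCosets H => p.1.out * p.2.out) ''
      ((Quotient.mk (QuotientGroup.rightRel H) '' Function.support f) ×ˢ
        (Function.support fun q : RightCosets H => g q.out)),
      ((finite_image_support hf).prod (finite_support_out hg)).image _, ?_⟩
    intro γ hγ
    obtain ⟨q, hq⟩ := exists_ne_zero_of_finsum hγ
    obtain ⟨h, hh, e⟩ := exists_out_eq (H := H) (γ * q.out⁻¹)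
    refine Set.mem_iUnion₂.2 ⟨_, ⟨(Quotient.mk _ (γ * q.out⁻¹), q),
      ⟨⟨_, left_ne_zero_of_mul hq, rfl⟩, right_ne_zero_of_mul hq⟩, rfl⟩, ?_⟩
    rw [DoubleCoset.mem_doubleCoset]
    refine ⟨h⁻¹, H.inv_mem hh, 1, H.one_mem, ?_⟩
    simp only [e]
    group

theorem conv_assoc [IsHeckePair H] {f g k : G → ℂ} (hf : f ∈ heckeSubmodule H)
    (hg : g ∈ heckeSubmodule H) (hk : k ∈ heckeSubmodule H) :
    conv H (conv H f g) k = conv H f (conv H g k) := by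
  funext γ
  have hL : conv H (conv H f g) k γ =
      ∑ᶠ q : RightCosets H, ∑ᶠ p : RightCosets H, f (γ * p.out⁻¹) * g (p.out * q.out⁻¹) *
        k q.out := by
    refine finsum_congr fun q => ?_
    rw [conv, ← finsum_translate (F := fun x => f (γ * q.out⁻¹ * x⁻¹) * g x) ?_ q.out⁻¹,
      finsum_mul]
    · refine finsum_congr fun p => ?_
      have : γ * q.out⁻¹ * (p.out * q.out⁻¹)⁻¹ = γ * p.out⁻¹ := by group
      rw [this]
    · intro h hh x
      have : γ * q.out⁻¹ * (h * x)⁻¹ = γ * q.out⁻¹ * x⁻¹ * h⁻¹ := by group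
      simp only [this]
      rw [right_inv_of_mem hf _ (H.inv_mem hh), left_inv_of_mem hg _ hh]
  have hR : conv H f (conv H g k) γ =
      ∑ᶠ p : RightCosets H, ∑ᶠ q : RightCosets H, f (γ * p.out⁻¹) * g (p.out * q.out⁻¹) *
        k q.out := by
    refine finsum_congr fun p => ?_
    rw [conv, mul_finsum]
    exact finsum_congr fun q => by ring
  rw [hL, hR]
  set S := (finite_support_out (H := H) hk).toFinset with hS
  have hq : ∀ F : RightCosets H → ℂ, ∑ᶠ q : RightCosets H, F q * k q.out =
      ∑ q ∈ S, F q * k q.out := fun F => by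
    refine finsum_eq_finsetSum_of_support_subset _ fun q hq => ?_
    simpa [hS] using right_ne_zero_of_mul hq
  have hfin : ∀ q : RightCosets H, (Function.support fun p : RightCosets H =>
      f (γ * p.out⁻¹) * g (p.out * q.out⁻¹) * k q.out).Finite := fun q => by
    refine (((finite_image_support hg)).image (rightTranslate H q.out)).subset fun p hp => ?_
    refine ⟨Quotient.mk _ (p.out * q.out⁻¹),
      ⟨_, right_ne_zero_of_mul (left_ne_zero_of_mul hp), rfl⟩, ?_⟩
    change Quotient.mk (QuotientGroup.rightRel H) (p.out * q.out⁻¹ * q.out) = p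
    rw [inv_mul_cancel_right, Quotient.out_eq]
  calc
    _ = ∑ q ∈ S, ∑ᶠ p : RightCosets H, f (γ * p.out⁻¹) * g (p.out * q.out⁻¹) * k q.out := by
      refine finsum_eq_finsetSum_of_support_subset _ fun q hq => ?_
      obtain ⟨p, hp⟩ := exists_ne_zero_of_finsum hq
      simpa [hS] using right_ne_zero_of_mul hp
    _ = ∑ᶠ p : RightCosets H, ∑ q ∈ S, f (γ * p.out⁻¹) * g (p.out * q.out⁻¹) * k q.out :=
      (finsum_sum_comm S _ fun q _ => hfin q).symm
    _ = _ := finsum_congr fun p => (hq fun q => f (γ * p.out⁻¹) * g (p.out * q.out⁻¹)).symm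

/-- The characteristic function of the double coset `H g H`. -/
noncomputable def doubleCosetFun (H : Subgroup G) (g : G) : G → ℂ :=
  Set.indicator (DoubleCoset.doubleCoset g H H) 1

theorem doubleCosetFun_mem (g : G) : doubleCosetFun H g ∈ heckeSubmodule H := by
  refine ⟨fun h hh k hk x => ?_, {g}, Set.finite_singleton g, ?_⟩
  · have : h * x * k ∈ DoubleCoset.doubleCoset g H H ↔ x ∈ DoubleCoset.doubleCoset g H H := by
      simp only [DoubleCoset.mem_doubleCoset]
      constructor
      · rintro ⟨a, ha, b, hb, e⟩
        refine ⟨h⁻¹ * a, H.mul_mem (H.inv_mem hh) ha, b * k⁻¹, H.mul_mem hb (H.inv_mem hk), ?_⟩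
        have : x = h⁻¹ * (h * x * k) * k⁻¹ := by group
        rw [this, e]; group
      · rintro ⟨a, ha, b, hb, rfl⟩
        exact ⟨h * a, H.mul_mem hh ha, b * k, H.mul_mem hb hk, by group⟩
    simp only [doubleCosetFun]
    by_cases hx : x ∈ DoubleCoset.doubleCoset g H H
    · rw [Set.indicator_of_mem hx, Set.indicator_of_mem (this.2 hx)]; rfl
    · rw [Set.indicator_of_notMem hx, Set.indicator_of_notMem (mt this.1 hx)]
  · simp [doubleCosetFun]

theorem doubleCoset_one : DoubleCoset.doubleCoset (1 : G) H H = (H : Set G) := by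
  ext x
  rw [DoubleCoset.mem_doubleCoset]
  constructor
  · rintro ⟨a, ha, b, hb, rfl⟩
    simpa using H.mul_mem ha hb
  · intro hx
    exact ⟨x, hx, 1, H.one_mem, by simp⟩

theorem one_mem : Set.indicator (H : Set G) 1 ∈ heckeSubmodule H := by
  have := doubleCosetFun_mem (H := H) 1
  rwa [doubleCosetFun, doubleCoset_one] at this

theorem conv_one {f : G → ℂ} (hf : f ∈ heckeSubmodule H) :
    conv H f (Set.indicator (H : Set G) 1) = f := by
  funext γ
  rw [conv, finsum_eq_single _ (Quotient.mk (QuotientGroup.rightRel H) 1)]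
  · obtain ⟨h, hh, e⟩ := exists_out_eq (H := H) 1
    rw [e, mul_one, Set.indicator_of_mem (show h ∈ (H : Set G) from hh),
      right_inv_of_mem hf _ (H.inv_mem hh)]
    simp
  · intro q hq
    rw [Set.indicator_of_notMem, mul_zero]
    intro hm
    apply hq
    rw [← Quotient.out_eq q]
    refine Quotient.sound ?_
    change (QuotientGroup.rightRel H) q.out 1
    rw [QuotientGroup.rightRel_apply, one_mul]
    exact H.inv_mem hm

theorem one_conv {f : G → ℂ} (hf : f ∈ heckeSubmodule H) :
    conv H (Set.indicator (H : Set G) 1) f = f := by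
  funext γ
  rw [conv, finsum_eq_single _ (Quotient.mk (QuotientGroup.rightRel H) γ)]
  · obtain ⟨h, hh, e⟩ := exists_out_eq (H := H) γ
    have e2 : γ * (h * γ)⁻¹ = h⁻¹ := by group
    rw [e, e2, Set.indicator_of_mem (show h⁻¹ ∈ (H : Set G) from H.inv_mem hh),
      left_inv_of_mem hf _ hh]
    simp
  · intro q hq
    rw [Set.indicator_of_notMem, zero_mul]
    intro hm
    apply hq
    rw [← Quotient.out_eq q]
    refine Quotient.sound ?_
    change (QuotientGroup.rightRel H) q.out γ
    rw [QuotientGroup.rightRel_apply]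
    exact hm

/-- The involution `f*(γ) = conj (f (γ⁻¹))` on functions. -/
noncomputable def involution (f : G → ℂ) (γ : G) : ℂ := star (f γ⁻¹)

theorem involution_mem {f : G → ℂ} (hf : f ∈ heckeSubmodule H) :
    involution f ∈ heckeSubmodule H := by
  obtain ⟨hf, s, hs, hfs⟩ := hf
  refine ⟨fun h hh k hk x => ?_, (·⁻¹) '' s, hs.image _, fun x hx => ?_⟩
  · have : (h * x * k)⁻¹ = k⁻¹ * x⁻¹ * h⁻¹ := by group
    rw [involution, involution, this, hf _ (H.inv_mem hk) _ (H.inv_mem hh)]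
  · have hx' : f x⁻¹ ≠ 0 := fun h0 => hx (by simp [involution, h0])
    obtain ⟨g, hg, hxg⟩ := Set.mem_iUnion₂.1 (hfs hx')
    obtain ⟨a, ha, b, hb, e⟩ := DoubleCoset.mem_doubleCoset.1 hxg
    refine Set.mem_iUnion₂.2 ⟨g⁻¹, ⟨g, hg, rfl⟩, DoubleCoset.mem_doubleCoset.2
      ⟨b⁻¹, H.inv_mem hb, a⁻¹, H.inv_mem ha, ?_⟩⟩
    rw [← inv_inv x, e]; group

theorem involution_conv [IsHeckePair H] {f g : G → ℂ} (hf : f ∈ heckeSubmodule H)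
    (hg : g ∈ heckeSubmodule H) :
    involution (conv H f g) = conv H (involution g) (involution f) := by
  funext γ
  have h1 : involution (conv H f g) γ =
      ∑ᶠ q : RightCosets H, star (f (γ⁻¹ * q.out⁻¹)) * star (g q.out) := by
    have hfin : (Function.support fun q : RightCosets H =>
        f (γ⁻¹ * q.out⁻¹) * g q.out).Finite :=
      (finite_support_out hg).subset fun q hq => right_ne_zero_of_mul hq
    rw [involution, conv]
    refine ((starAddEquiv (R := ℂ)).toAddMonoidHom.map_finsum hfin).trans ?_
    exact finsum_congr fun q => by simp [mul_comm]
  rw [h1, conv, ← finsum_translate (F := fun x => involution g (γ * x⁻¹) * involution f x) ?_ γ]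
  · refine finsum_congr fun q => ?_
    have e1 : (γ * (q.out * γ)⁻¹)⁻¹ = q.out := by group
    have e2 : (q.out * γ)⁻¹ = γ⁻¹ * q.out⁻¹ := by group
    simp only [involution, e1]
    rw [e2, mul_comm]
  · intro h hh x
    have : γ * (h * x)⁻¹ = γ * x⁻¹ * h⁻¹ := by group
    simp only [this]
    rw [right_inv_of_mem (involution_mem hg) _ (H.inv_mem hh),
      left_inv_of_mem (involution_mem hf) _ hh]

theorem conv_add [IsHeckePair H] {f g k : G → ℂ} (hg : g ∈ heckeSubmodule H)
    (hk : k ∈ heckeSubmodule H) : conv H f (g + k) = conv H f g + conv H f k := by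
  funext γ
  have h : ∀ {g : G → ℂ}, g ∈ heckeSubmodule H → (Function.support fun q : RightCosets H =>
        f (γ * q.out⁻¹) * g q.out).Finite := fun hg =>
    (finite_support_out hg).subset fun q hq => right_ne_zero_of_mul hq
  rw [Pi.add_apply, conv, conv, conv, ← finsum_add_distrib (h hg) (h hk)]
  exact finsum_congr fun q => by simp [mul_add]

theorem add_conv [IsHeckePair H] {f g k : G → ℂ} (hk : k ∈ heckeSubmodule H) :
    conv H (f + g) k = conv H f k + conv H g k := by
  funext γ
  have h : ∀ f : G → ℂ, (Function.support fun q : RightCosets H =>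
        f (γ * q.out⁻¹) * k q.out).Finite := fun _ =>
    (finite_support_out hk).subset fun q hq => right_ne_zero_of_mul hq
  rw [Pi.add_apply, conv, conv, conv, ← finsum_add_distrib (h f) (h g)]
  exact finsum_congr fun q => by simp [add_mul]

theorem smul_conv (c : ℂ) (f g : G → ℂ) : conv H (c • f) g = c • conv H f g := by
  funext γ
  rw [Pi.smul_apply, smul_eq_mul, conv, conv, mul_finsum]
  exact finsum_congr fun q => by simp [mul_assoc]

theorem conv_smul (c : ℂ) (f g : G → ℂ) : conv H f (c • g) = c • conv H f g := by
  funext γ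
  rw [Pi.smul_apply, smul_eq_mul, conv, conv, mul_finsum]
  exact finsum_congr fun q => by simp [mul_left_comm]

end Aux

section Structure

variable {G : Type u} [Group G] {H : Subgroup G}

noncomputable instance : AddCommGroup (HeckeAlgebra H) :=
  inferInstanceAs (AddCommGroup (heckeSubmodule H))

noncomputable instance : Module ℂ (HeckeAlgebra H) :=
  inferInstanceAs (Module ℂ (heckeSubmodule H))

noncomputable instance [IsHeckePair H] : Ring (HeckeAlgebra H) where
  mul f g := ⟨conv H f.1 g.1, conv_mem f.2 g.2⟩
  one := ⟨Set.indicator (H : Set G) 1, one_mem⟩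
  mul_assoc f g k := Subtype.ext (conv_assoc f.2 g.2 k.2)
  one_mul f := Subtype.ext (one_conv f.2)
  mul_one f := Subtype.ext (conv_one f.2)
  left_distrib _ g k := Subtype.ext (conv_add g.2 k.2)
  right_distrib _ _ k := Subtype.ext (add_conv k.2)
  zero_mul g := Subtype.ext (funext fun _ => by
    change ∑ᶠ q : RightCosets H, (0 : ℂ) * g.1 q.out = 0
    simp)
  mul_zero f := Subtype.ext (funext fun γ => by
    change ∑ᶠ q : RightCosets H, f.1 (γ * q.out⁻¹) * (0 : ℂ) = 0
    simp)
  neg_add_cancel := neg_add_cancel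
  zsmul := fun n f => n • f
  zsmul_zero' := SubNegMonoid.zsmul_zero'
  zsmul_succ' := SubNegMonoid.zsmul_succ'
  zsmul_neg' := SubNegMonoid.zsmul_neg'
  nsmul := fun n f => n • f
  nsmul_zero := AddMonoid.nsmul_zero
  nsmul_succ := AddMonoid.nsmul_succ
  sub_eq_add_neg := sub_eq_add_neg

noncomputable instance [IsHeckePair H] : Algebra ℂ (HeckeAlgebra H) :=
  Algebra.ofModule (fun c f g => Subtype.ext (smul_conv c f.1 g.1))
    (fun c f g => Subtype.ext (conv_smul c f.1 g.1))

noncomputable instance [IsHeckePair H] : StarRing (HeckeAlgebra H) where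
  star f := ⟨involution f.1, involution_mem f.2⟩
  star_involutive f := Subtype.ext (funext fun γ => by simp [involution])
  star_mul f g := Subtype.ext (involution_conv f.2 g.2)
  star_add f g := Subtype.ext (funext fun γ =>
    star_add (f.1 γ⁻¹) (g.1 γ⁻¹))

instance [IsHeckePair H] : StarModule ℂ (HeckeAlgebra H) where
  star_smul c f := Subtype.ext (funext fun γ => by
    change star (c * f.1 γ⁻¹) = star c * star (f.1 γ⁻¹)
    rw [star_mul'])

/-- The characteristic function `[H g H]` as an element of the Hecke algebra. -/
noncomputable def doubleCosetElem (H : Subgroup G) (g : G) : HeckeAlgebra H :=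
  ⟨doubleCosetFun H g, doubleCosetFun_mem g⟩

end Structure

end HeckePair

/-! ### The `ax+b` groups -/

universe v w

/-- The group of matrices `!![1, y; 0, x]` with `y ∈ R` and `x ∈ Rˣ`. -/
@[ext]
structure AxB (R : Type v) [CommRing R] : Type v where
  y : R
  x : Rˣ

namespace AxB

section

variable {R S : Type v} [CommRing R] [CommRing S]

instance : Mul (AxB R) := ⟨fun p q => ⟨q.y + p.y * q.x, p.x * q.x⟩⟩
instance : One (AxB R) := ⟨⟨0, 1⟩⟩
instance : Inv (AxB R) := ⟨fun p => ⟨-(p.y * ↑p.x⁻¹), p.x⁻¹⟩⟩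

theorem mul_y (p q : AxB R) : (p * q).y = q.y + p.y * q.x := rfl
theorem mul_x (p q : AxB R) : (p * q).x = p.x * q.x := rfl
theorem one_y : (1 : AxB R).y = 0 := rfl
theorem one_x : (1 : AxB R).x = 1 := rfl
theorem inv_y (p : AxB R) : p⁻¹.y = -(p.y * ↑p.x⁻¹) := rfl
theorem inv_x (p : AxB R) : p⁻¹.x = p.x⁻¹ := rfl

instance : Group (AxB R) :=
  Group.ofLeftAxioms
    (fun p q r => by
      ext
      · simp only [mul_y, mul_x, Units.val_mul]; ring
      · simp only [mul_x, mul_assoc])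
    (fun p => by ext <;> simp [mul_y, mul_x, one_y, one_x])
    (fun p => by ext <;> simp [mul_y, mul_x, one_y, one_x, inv_y, inv_x])

/-- The matrix of an element. -/
def toMatrix (p : AxB R) : Matrix (Fin 2) (Fin 2) R := !![1, p.y; 0, (p.x : R)]

theorem toMatrix_mul (p q : AxB R) : (p * q).toMatrix = p.toMatrix * q.toMatrix := by
  simp [toMatrix, mul_y, mul_x]

/-- The homomorphism of `ax+b` groups induced by a ring homomorphism. -/
def map (f : R →+* S) : AxB R →* AxB S where
  toFun p := ⟨f p.y, Units.map (f : R →* S) p.x⟩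
  map_one' := by ext <;> simp [one_y, one_x]
  map_mul' p q := by ext <;> simp [mul_y, mul_x]

theorem map_y (f : R →+* S) (p : AxB R) : (map f p).y = f p.y := rfl
theorem map_x (f : R →+* S) (p : AxB R) : (map f p).x = Units.map (f : R →* S) p.x := rfl

instance [Finite R] : Finite (AxB R) :=
  Finite.of_injective (fun p : AxB R => (p.y, p.x)) fun p q h => by
    simp only [Prod.mk.injEq] at h
    exact AxB.ext h.1 h.2

end

end AxB

/-! ### The Hecke pair of a number field -/

namespace NFHecke

open HeckePair

variable (K : Type v) [Field K] [NumberField K]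

/-- The group `P_K`, all matrices `!![1, y; 0, x]` with `y ∈ K`, `x ∈ Kˣ`. -/
abbrev PK : Type v := AxB K

/-- The subgroup `P_𝓞` of `P_K`, the matrices with `y ∈ 𝓞` and `x ∈ 𝓞ˣ`. -/
def PO : Subgroup (PK K) := (AxB.map (algebraMap (𝓞 K) K)).range

/-- The quotient `K / 𝓞`, an `𝓞`-module. -/
abbrev KModO : Type v := K ⧸ LinearMap.range (Algebra.linearMap (𝓞 K) K)

/-- The class of `x ∈ K` in `K / 𝓞`. -/
def cls (x : K) : KModO K := Submodule.Quotient.mk x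

variable {K}

theorem finite_quotient_span {d : 𝓞 K} (hd : d ≠ 0) : Finite (𝓞 K ⧸ Ideal.span {d}) :=
  Ideal.finiteQuotientOfFreeOfNeBot _ (by simpa using hd)

theorem exists_denominator (z w : K) :
    ∃ d : 𝓞 K, d ≠ 0 ∧ (∃ a : 𝓞 K, algebraMap (𝓞 K) K a = algebraMap (𝓞 K) K d * z) ∧
      ∃ b : 𝓞 K, algebraMap (𝓞 K) K b = algebraMap (𝓞 K) K d * w := by
  obtain ⟨a, b, hb, rfl⟩ := IsFractionRing.div_surjective (A := 𝓞 K) z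
  obtain ⟨c, e, he, rfl⟩ := IsFractionRing.div_surjective (A := 𝓞 K) w
  have hb0 : algebraMap (𝓞 K) K b ≠ 0 := by simpa using nonZeroDivisors.ne_zero hb
  have he0 : algebraMap (𝓞 K) K e ≠ 0 := by simpa using nonZeroDivisors.ne_zero he
  refine ⟨b * e, mul_ne_zero (nonZeroDivisors.ne_zero hb) (nonZeroDivisors.ne_zero he),
    ⟨a * e, ?_⟩, ⟨c * b, ?_⟩⟩
  · simp only [map_mul]
    field_simp
  · simp only [map_mul]
    field_simp

/-- `(P_K, P_𝓞)` is a Hecke pair. -/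
instance : IsHeckePair (PO K) where
  finite_rightCosetsIn γ := by
    obtain ⟨d, hd, ⟨a, ha⟩, ⟨b, hb⟩⟩ := exists_denominator ((γ.x : K)⁻¹) (γ.y * (γ.x : K)⁻¹)
    have hx : (γ.x : K) ≠ 0 := γ.x.ne_zero
    have := finite_quotient_span hd
    let π : AxB (𝓞 K) →* AxB (𝓞 K ⧸ Ideal.span {d}) := AxB.map (Ideal.Quotient.mk _)
    let ι : AxB (𝓞 K) →* PK K := AxB.map (algebraMap (𝓞 K) K)
    let F : AxB (𝓞 K) → RightCosets (PO K) := fun h => Quotient.mk _ (γ * ι h)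
    have key : ∀ k : AxB (𝓞 K), π k = 1 → γ * ι k * γ⁻¹ ∈ PO K := by
      intro k hk
      have h1 : Ideal.Quotient.mk (Ideal.span {d}) k.y = 0 := congrArg AxB.y hk
      have h2 : Ideal.Quotient.mk (Ideal.span {d}) (k.x : 𝓞 K) = 1 :=
        congrArg (fun p : AxB (𝓞 K ⧸ Ideal.span {d}) => (p.x : 𝓞 K ⧸ Ideal.span {d})) hk
      rw [Ideal.Quotient.eq_zero_iff_mem, Ideal.mem_span_singleton] at h1
      rw [← map_one (Ideal.Quotient.mk (Ideal.span {d})), Ideal.Quotient.mk_eq_mk_iff_sub_mem,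
        Ideal.mem_span_singleton] at h2
      obtain ⟨s, hs⟩ := h1
      obtain ⟨t, ht⟩ := h2
      have hs' : algebraMap (𝓞 K) K k.y = algebraMap (𝓞 K) K d * algebraMap (𝓞 K) K s := by rw [hs, map_mul]
      have ht' : algebraMap (𝓞 K) K k.x = 1 + algebraMap (𝓞 K) K d * algebraMap (𝓞 K) K t := by
        rw [← map_mul, ← ht]; simp
      refine ⟨⟨s * a + b * t, k.x⟩, ?_⟩
      ext
      · simp only [AxB.map_y, AxB.mul_y, AxB.inv_y, AxB.inv_x, map_add, map_mul, ι, ha, hb,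
          AxB.map_x, Units.coe_map, MonoidHom.coe_coe, hs', ht', Units.val_inv_eq_inv_val]
        field_simp
        ring
      · simp only [AxB.map_x, AxB.mul_x, AxB.inv_x, ι]
        simp [mul_comm]
    have hF : ∀ h h', π h = π h' → F h = F h' := by
      intro h h' e
      refine Quotient.sound ?_
      change (QuotientGroup.rightRel (PO K)) _ _
      rw [QuotientGroup.rightRel_apply]
      have := key (h' * h⁻¹) (by rw [map_mul, map_inv, e, mul_inv_cancel])
      rw [map_mul, map_inv] at this
      convert this using 1
      group
    have hfac : Function.FactorsThrough F π := fun h h' e => hF h h' e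
    refine (Set.finite_range (fun p => Function.extend π F (fun _ => F 1) p)).subset ?_
    rintro _ ⟨g, hg, rfl⟩
    obtain ⟨p, hp, q, ⟨h, rfl⟩, rfl⟩ := DoubleCoset.mem_doubleCoset.1 hg
    refine ⟨π h, ?_⟩
    change Function.extend π F (fun _ => F 1) (π h) = _
    rw [hfac.extend_apply]
    refine Quotient.sound ?_
    change (QuotientGroup.rightRel (PO K)) _ _
    rw [QuotientGroup.rightRel_apply]
    convert (show p ∈ PO K from hp) using 1
    change p * γ * ι h * (γ * ι h)⁻¹ = p
    group

noncomputable instance fintypeQuotientSpan (a : (𝓞 K)⁰) :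
    Fintype (𝓞 K ⧸ Ideal.span {(a : 𝓞 K)}) :=
  haveI := finite_quotient_span (nonZeroDivisors.coe_ne_zero a)
  Fintype.ofFinite _

/-- The index of the stabilizer `𝓞ˣ_r` in `𝓞ˣ` is finite. -/
noncomputable instance fintypeUnitsQuotient (r : KModO K) :
    Fintype ((𝓞 K)ˣ ⧸ MulAction.stabilizer (𝓞 K)ˣ r) :=
  haveI : Finite ((𝓞 K)ˣ ⧸ MulAction.stabilizer (𝓞 K)ˣ r) := by
    obtain ⟨z, rfl⟩ := Submodule.Quotient.mk_surjective _ r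
    obtain ⟨d, hd, ⟨a, ha⟩, -⟩ := exists_denominator z 0
    have := finite_quotient_span hd
    let π : (𝓞 K)ˣ →* (𝓞 K ⧸ Ideal.span {d})ˣ :=
      Units.map (Ideal.Quotient.mk (Ideal.span {d}) : 𝓞 K →* 𝓞 K ⧸ Ideal.span {d})
    have hle : π.ker ≤ MulAction.stabilizer (𝓞 K)ˣ
        (Submodule.Quotient.mk z : KModO K) := by
      intro u hu
      rw [MonoidHom.mem_ker] at hu
      have h2 : Ideal.Quotient.mk (Ideal.span {d}) (u : 𝓞 K) = 1 := congrArg Units.val hu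
      rw [← map_one (Ideal.Quotient.mk (Ideal.span {d})), Ideal.Quotient.mk_eq_mk_iff_sub_mem,
        Ideal.mem_span_singleton] at h2
      obtain ⟨t, ht⟩ := h2
      rw [MulAction.mem_stabilizer_iff, Units.smul_def, ← Submodule.Quotient.mk_smul,
        Submodule.Quotient.eq]
      refine ⟨t * a, ?_⟩
      have ht' : algebraMap (𝓞 K) K u = 1 + algebraMap (𝓞 K) K d * algebraMap (𝓞 K) K t := by
        rw [← map_mul, ← ht]; simp
      rw [Algebra.linearMap_apply, map_mul, ha, Algebra.smul_def, ht']
      ring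
    have : π.ker.FiniteIndex := inferInstance
    have := Subgroup.finiteIndex_of_le hle
    exact Subgroup.finite_quotient_of_finiteIndex
  Fintype.ofFinite _

/-- The matrix `!![1, x; 0, 1]`. -/
def unip (x : K) : PK K := ⟨x, 1⟩

theorem doubleCoset_unip {x y : K} (h : cls K x = cls K y) :
    DoubleCoset.doubleCoset (unip x) (PO K) (PO K) =
      DoubleCoset.doubleCoset (unip y) (PO K) (PO K) := by
  refine DoubleCoset.doubleCoset_eq_of_mem (DoubleCoset.mem_doubleCoset.2 ?_)
  obtain ⟨c, hc⟩ := (Submodule.Quotient.eq _).1 h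
  refine ⟨AxB.map (algebraMap (𝓞 K) K) ⟨c, 1⟩, ⟨_, rfl⟩, 1, (PO K).one_mem, ?_⟩
  rw [Algebra.linearMap_apply] at hc
  ext
  · simp [AxB.mul_y, AxB.map_y, unip, hc]
  · simp [AxB.mul_x, AxB.map_x, unip]

/-- `R(r)` for `r ∈ K / 𝓞`: the number of right cosets in the double coset of `!![1, r; 0, 1]`. -/
noncomputable def numR (r : KModO K) : ℕ :=
  Quotient.liftOn' r (fun x => numRightCosets (PO K) (unip x)) fun x y h => by
    have h' : cls K x = cls K y := Quotient.sound' h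
    simp only [numRightCosets, rightCosetsIn, doubleCoset_unip h']

/-- `θ_r = R(r)⁻¹ [P_𝓞 !![1, r; 0, 1] P_𝓞]` for `r ∈ K / 𝓞`. -/
noncomputable def theta (r : KModO K) : HeckeAlgebra (PO K) :=
  Quotient.liftOn' r
    (fun x => (1 / (numRightCosets (PO K) (unip x) : ℂ)) • doubleCosetElem (PO K) (unip x))
    fun x y h => by
      have h' : cls K x = cls K y := Quotient.sound' h
      simp only [numRightCosets, rightCosetsIn, doubleCosetElem, doubleCosetFun,
        doubleCoset_unip h']

/-- The absolute norm `N_a = |𝓞 / a𝓞|`. -/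
noncomputable def normN (a : (𝓞 K)⁰) : ℕ := Nat.card (𝓞 K ⧸ Ideal.span {(a : 𝓞 K)})

/-- The matrix `!![1, 0; 0, a]` for a nonzero integer `a`. -/
noncomputable def diag (a : (𝓞 K)⁰) : PK K :=
  ⟨0, Units.mk0 (algebraMap (𝓞 K) K a) (by simp)⟩

/-- `μ_a = N_a^(-1/2) [P_𝓞 !![1, 0; 0, a] P_𝓞]` for a nonzero integer `a`. -/
noncomputable def mu (a : (𝓞 K)⁰) : HeckeAlgebra (PO K) :=
  ((1 / Real.sqrt (normN a) : ℝ) : ℂ) • doubleCosetElem (PO K) (diag a)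

/-- The class of `(x + b) / a` in `K / 𝓞`, for `b ∈ 𝓞 / a𝓞`. -/
noncomputable def divClass (a : (𝓞 K)⁰) (x : K) (b : 𝓞 K ⧸ Ideal.span {(a : 𝓞 K)}) : KModO K :=
  Quotient.liftOn' b (fun c : 𝓞 K => cls K ((x + algebraMap (𝓞 K) K c) / algebraMap (𝓞 K) K a)) fun c c' h => by
    rw [Submodule.quotientRel_def] at h
    obtain ⟨e, he⟩ := Ideal.mem_span_singleton.1 h
    refine (Submodule.Quotient.eq _).2 ⟨e, ?_⟩
    have ha : algebraMap (𝓞 K) K a ≠ 0 := by simp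
    have he' : algebraMap (𝓞 K) K c - algebraMap (𝓞 K) K c' =
        algebraMap (𝓞 K) K a * algebraMap (𝓞 K) K e := by
      rw [← map_mul, ← he, map_sub]
    rw [Algebra.linearMap_apply, ← sub_div, add_sub_add_left_eq_sub, he',
      mul_div_cancel_left₀ _ ha]


/-- The defining relations, for families `m : 𝓞 \ {0} → A` and `t : K / 𝓞 → A` of elements of a
unital complex *-algebra `A`. -/
structure Relations {A : Type w} [Ring A] [StarRing A] [Algebra ℂ A]
    (m : (𝓞 K)⁰ → A) (t : KModO K → A) : Prop where
  /-- units act trivially -/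
  mu_unit : ∀ a : (𝓞 K)⁰, IsUnit (a : 𝓞 K) → m a = 1
  /-- each `m a` is an isometry -/
  star_mu_mul_mu : ∀ a, star (m a) * m a = 1
  /-- `m` is multiplicative -/
  mu_mul : ∀ a b, m a * m b = m (a * b)
  /-- `t` is normalized -/
  theta_zero : t 0 = 1
  /-- `t` is constant on `𝓞ˣ`-orbits -/
  theta_smul : ∀ (r : KModO K) (w : (𝓞 K)ˣ), t (w • r) = t r
  /-- each `t r` is self-adjoint -/
  star_theta : ∀ r, star (t r) = t r
  /-- the product formula; `MulAction.ofQuotientStabilizer _ r u` is `u r` for `u ∈ 𝓞ˣ / 𝓞ˣ_r`. -/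
  theta_mul : ∀ r s : KModO K, t r * t s =
    ((1 / (numR r : ℂ)) * (1 / (numR s : ℂ))) •
      ∑ u : (𝓞 K)ˣ ⧸ MulAction.stabilizer (𝓞 K)ˣ r,
        ∑ v : (𝓞 K)ˣ ⧸ MulAction.stabilizer (𝓞 K)ˣ s,
          t (MulAction.ofQuotientStabilizer (𝓞 K)ˣ r u +
            MulAction.ofQuotientStabilizer (𝓞 K)ˣ s v)
  /-- the covariance relation, for the class of an arbitrary `x ∈ K` -/
  mu_theta_star_mu : ∀ (a : (𝓞 K)⁰) (x : K), m a * t (cls K x) * star (m a) =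
    (1 / (normN a : ℂ)) • ∑ b : 𝓞 K ⧸ Ideal.span {(a : 𝓞 K)}, t (divClass a x b)

/-- The set of monomials `μ_a^* θ_r μ_b`. -/
def monomials (K : Type v) [Field K] [NumberField K] : Set (HeckeAlgebra (PO K)) :=
  {f | ∃ (a b : (𝓞 K)⁰) (r : KModO K), f = star (mu a) * theta r * mu b}

end NFHecke

/-!
The functions `[P_𝓞 γ P_𝓞] / R(γ)` multiply by averaging over representatives of the right cosets in
the first double coset, which turns the defining relations into computations with matrices.

Conversely, let `m`, `t` satisfy the relations. The `a`-torsion of `K / 𝓞` is stable under units, so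
summing `t` over it and averaging over unit orbits commute; hence `t (x) m_a = m_a t (a x)`. It
follows that `m_a^* t_x m_b` depends only on the double coset of the matrix `!![1, x b; 0, b / a]`,
and every matrix over `K` has this form. For `μ`, `θ` this monomial is a nonzero multiple of the
characteristic function of that double coset, so the monomials form a basis and there is a linear
map `μ_a^* θ_x μ_b ↦ m_a^* t_x m_b`. Its graph is spanned by the monomials of the pairs
`(μ_a, m_a)`, `(θ_x, t_x)`, which again satisfy the relations, and the span of the monomials of any
solution is closed under products; so the map is multiplicative.
-/

/-! ### Double cosets and the product of normalized double coset functions -/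

namespace HeckePair

section DoubleCosets

variable {G : Type*} [Group G] {H : Subgroup G}

/-- The right coset `H g`. -/
abbrev rightCosetMk (H : Subgroup G) (g : G) : RightCosets H :=
  Quotient.mk (QuotientGroup.rightRel H) g

theorem rightCosetMk_eq_iff {a b : G} :
    rightCosetMk H a = rightCosetMk H b ↔ b * a⁻¹ ∈ H :=
  Quotient.eq.trans QuotientGroup.rightRel_apply

theorem mul_mem_doubleCoset {g h k : G} (hh : h ∈ H) (hk : k ∈ H) :
    h * g * k ∈ DoubleCoset.doubleCoset g H H :=
  DoubleCoset.mem_doubleCoset.2 ⟨h, hh, k, hk, rfl⟩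

theorem rightCosetMk_mem_rightCosetsIn {a g : G} :
    rightCosetMk H a ∈ rightCosetsIn H g ↔ a ∈ DoubleCoset.doubleCoset g H H := by
  refine ⟨?_, fun ha => ⟨a, ha, rfl⟩⟩
  rintro ⟨b, hb, hba⟩
  obtain ⟨h, hh, k, hk, rfl⟩ := DoubleCoset.mem_doubleCoset.1 hb
  have hah : a * (h * g * k)⁻¹ ∈ H := rightCosetMk_eq_iff.1 hba
  exact DoubleCoset.mem_doubleCoset.2 ⟨_, H.mul_mem hah hh, k, hk, by group⟩

theorem exists_eq_rightCosetMk_mul {g : G} {q : RightCosets H} (hq : q ∈ rightCosetsIn H g) :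
    ∃ k ∈ H, q = rightCosetMk H (g * k) := by
  obtain ⟨_, ha, rfl⟩ := hq
  obtain ⟨h, hh, k, hk, rfl⟩ := DoubleCoset.mem_doubleCoset.1 ha
  exact ⟨k, hk, rightCosetMk_eq_iff.2 (by simpa [mul_assoc] using hh)⟩

theorem rightCosetsIn_congr {a g : G} (ha : a ∈ DoubleCoset.doubleCoset g H H) :
    rightCosetsIn H a = rightCosetsIn H g := by
  rw [rightCosetsIn, rightCosetsIn, DoubleCoset.doubleCoset_eq_of_mem ha]

theorem mem_doubleCoset_comm {a g : G} :
    a ∈ DoubleCoset.doubleCoset g H H ↔ g ∈ DoubleCoset.doubleCoset a H H := by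
  suffices ∀ {a g : G}, a ∈ DoubleCoset.doubleCoset g H H → g ∈ DoubleCoset.doubleCoset a H H from
    ⟨this, this⟩
  intro a g ha
  rw [DoubleCoset.doubleCoset_eq_of_mem ha]
  exact DoubleCoset.mem_doubleCoset_self H H g

theorem inv_mem_doubleCoset_inv {a g : G} :
    a⁻¹ ∈ DoubleCoset.doubleCoset g⁻¹ H H ↔ a ∈ DoubleCoset.doubleCoset g H H := by
  suffices ∀ {a g : G}, a ∈ DoubleCoset.doubleCoset g H H →
      a⁻¹ ∈ DoubleCoset.doubleCoset g⁻¹ H H from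
    ⟨fun h => by simpa using this h, this⟩
  intro a g ha
  obtain ⟨h, hh, k, hk, rfl⟩ := DoubleCoset.mem_doubleCoset.1 ha
  exact DoubleCoset.mem_doubleCoset.2 ⟨k⁻¹, H.inv_mem hk, h⁻¹, H.inv_mem hh, by group⟩

end DoubleCosets

section Elements

variable {G : Type*} [Group G] {H : Subgroup G}

theorem doubleCosetFun_apply_of_mem {a g : G} (ha : a ∈ DoubleCoset.doubleCoset g H H) :
    doubleCosetFun H g a = 1 :=
  Set.indicator_of_mem ha _

theorem doubleCosetFun_apply_of_notMem {a g : G} (ha : a ∉ DoubleCoset.doubleCoset g H H) :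
    doubleCosetFun H g a = 0 :=
  Set.indicator_of_notMem ha _

theorem doubleCosetElem_congr {a g : G} (ha : a ∈ DoubleCoset.doubleCoset g H H) :
    doubleCosetElem H a = doubleCosetElem H g :=
  Subtype.ext <| by
    simp only [doubleCosetElem, doubleCosetFun, DoubleCoset.doubleCoset_eq_of_mem ha]

theorem star_doubleCosetElem [IsHeckePair H] (g : G) :
    star (doubleCosetElem H g) = doubleCosetElem H g⁻¹ := by
  refine Subtype.ext <| funext fun γ => ?_
  change star (doubleCosetFun H g γ⁻¹) = doubleCosetFun H g⁻¹ γ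
  have hmem : γ⁻¹ ∈ DoubleCoset.doubleCoset g H H ↔ γ ∈ DoubleCoset.doubleCoset g⁻¹ H H := by
    simpa using inv_mem_doubleCoset_inv (H := H) (a := γ) (g := g⁻¹)
  by_cases hγ : γ ∈ DoubleCoset.doubleCoset g⁻¹ H H
  · rw [doubleCosetFun_apply_of_mem hγ, doubleCosetFun_apply_of_mem (hmem.2 hγ), star_one]
  · rw [doubleCosetFun_apply_of_notMem hγ, doubleCosetFun_apply_of_notMem (mt hmem.1 hγ),
      star_zero]

theorem doubleCosetElem_one [IsHeckePair H] : doubleCosetElem H (1 : G) = 1 :=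
  Subtype.ext <| by
    change Set.indicator (DoubleCoset.doubleCoset (1 : G) H H) 1 = Set.indicator (H : Set G) 1
    rw [doubleCoset_one]

/-- The characteristic function `[H g H]` divided by the number of right cosets in `H g H`. -/
noncomputable def normalizedElem (H : Subgroup G) (g : G) : HeckeAlgebra H :=
  (1 / (numRightCosets H g : ℂ)) • doubleCosetElem H g

theorem normalizedElem_congr {a g : G} (ha : a ∈ DoubleCoset.doubleCoset g H H) :
    normalizedElem H a = normalizedElem H g := by
  rw [normalizedElem, normalizedElem, doubleCosetElem_congr ha, numRightCosets, numRightCosets,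
    rightCosetsIn_congr ha]

theorem normalizedElem_mul_right {k : G} (hk : k ∈ H) (g : G) :
    normalizedElem H (g * k) = normalizedElem H g :=
  normalizedElem_congr (by simpa using mul_mem_doubleCoset (g := g) H.one_mem hk)

theorem normalizedElem_mul_left {h : G} (hh : h ∈ H) (g : G) :
    normalizedElem H (h * g) = normalizedElem H g :=
  normalizedElem_congr (by simpa using mul_mem_doubleCoset (g := g) hh H.one_mem)

theorem numRightCosets_ne_zero [IsHeckePair H] (g : G) : numRightCosets H g ≠ 0 :=
  Set.ncard_ne_zero_of_mem (rightCosetMk_mem_rightCosetsIn.2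
    (DoubleCoset.mem_doubleCoset_self H H g)) (IsHeckePair.finite_rightCosetsIn g)

theorem doubleCosetElem_eq_smul_normalizedElem [IsHeckePair H] (g : G) :
    doubleCosetElem H g = (numRightCosets H g : ℂ) • normalizedElem H g := by
  rw [normalizedElem, smul_smul, mul_one_div_cancel (by simp [numRightCosets_ne_zero]), one_smul]

end Elements

section Basis

variable {G : Type*} [Group G] (H : Subgroup G)

theorem apply_eq_of_mem_doubleCoset {H : Subgroup G} (f : HeckeAlgebra H) {a g : G}
    (ha : a ∈ DoubleCoset.doubleCoset g H H) : f.1 a = f.1 g := by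
  obtain ⟨h, hh, k, hk, rfl⟩ := DoubleCoset.mem_doubleCoset.1 ha
  exact f.2.1 h hh k hk g

/-- Evaluation at a group element, as a linear functional on the Hecke algebra. -/
def evalAt (g : G) : HeckeAlgebra H →ₗ[ℂ] ℂ where
  toFun f := f.1 g
  map_add' _ _ := rfl
  map_smul' _ _ := rfl

theorem evalAt_doubleCosetElem_out (g : G) (D : DoubleCoset.Quotient (H : Set G) H)
    [Decidable (DoubleCoset.mk H H g = D)] :
    evalAt H g (doubleCosetElem H D.out) = if DoubleCoset.mk H H g = D then 1 else 0 := by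
  have hmem : g ∈ DoubleCoset.doubleCoset D.out H H ↔ DoubleCoset.mk H H g = D :=
    DoubleCoset.mem_quotToDoubleCoset_iff D g
  split_ifs with h
  · exact doubleCosetFun_apply_of_mem (hmem.2 h)
  · exact doubleCosetFun_apply_of_notMem (mt hmem.1 h)

theorem linearIndependent_doubleCosetElem_out :
    LinearIndependent ℂ fun D : DoubleCoset.Quotient (H : Set G) H => doubleCosetElem H D.out := by
  classical
  exact LinearIndependent.of_pairwise_dual_eq_zero_one _ (fun D => evalAt H D.out)
    (fun D E hDE => by simp [evalAt_doubleCosetElem_out, DoubleCoset.out_eq', hDE])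
    fun D => by simp [evalAt_doubleCosetElem_out, DoubleCoset.out_eq']

theorem exists_eq_sum_smul_doubleCosetElem (f : HeckeAlgebra H) :
    ∃ T : Finset (DoubleCoset.Quotient (H : Set G) H),
      f = ∑ D ∈ T, evalAt H D.out f • doubleCosetElem H D.out := by
  classical
  obtain ⟨s, hs, hfs⟩ := f.2.2
  refine ⟨(hs.image (DoubleCoset.mk H H)).toFinset, Subtype.ext <| funext fun γ => ?_⟩
  change evalAt H γ f = evalAt H γ _
  simp only [map_sum, map_smul, evalAt_doubleCosetElem_out, smul_eq_mul, mul_ite, mul_one, mul_zero,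
    Finset.sum_ite_eq, Set.Finite.mem_toFinset]
  split_ifs with hγ
  · exact apply_eq_of_mem_doubleCoset f ((DoubleCoset.mem_quotToDoubleCoset_iff _ γ).2 rfl)
  · refine Function.notMem_support.1 fun hγf => hγ ?_
    obtain ⟨g, hg, hγg⟩ := Set.mem_iUnion₂.1 (hfs hγf)
    exact ⟨g, hg, DoubleCoset.mk_eq_of_doubleCoset_eq (DoubleCoset.doubleCoset_eq_of_mem hγg).symm⟩

/-- The characteristic functions of the double cosets form a basis of the Hecke algebra, indexed
by the double cosets. -/
noncomputable def doubleCosetBasis :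
    Module.Basis (DoubleCoset.Quotient (H : Set G) H) ℂ (HeckeAlgebra H) :=
  Module.Basis.mk (linearIndependent_doubleCosetElem_out H) <| by
    rintro f -
    obtain ⟨T, hT⟩ := exists_eq_sum_smul_doubleCosetElem H f
    rw [hT]
    exact Submodule.sum_mem _ fun D _ => Submodule.smul_mem _ _ (Submodule.subset_span ⟨D, rfl⟩)

theorem doubleCosetBasis_apply (D : DoubleCoset.Quotient (H : Set G) H) :
    doubleCosetBasis H D = doubleCosetElem H D.out :=
  Module.Basis.mk_apply _ _ D

end Basis

section Transversals

variable {G : Type*} [Group G] {H : Subgroup G} {ι : Type*} {g : G} {a : ι → G}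

/-- The elements `a i` represent every right coset contained in `H g H` exactly once. -/
def IsTransversal (H : Subgroup G) (g : G) (a : ι → G) : Prop :=
  Set.BijOn (fun i => rightCosetMk H (a i)) Set.univ (rightCosetsIn H g)

theorem IsTransversal.of_mul_inv_mem (mem : ∀ i, a i ∈ DoubleCoset.doubleCoset g H H)
    (inj : ∀ i j, a j * (a i)⁻¹ ∈ H → i = j) (surj : ∀ k ∈ H, ∃ i, g * k * (a i)⁻¹ ∈ H) :
    IsTransversal H g a := by
  refine ⟨fun i _ => rightCosetMk_mem_rightCosetsIn.2 (mem i),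
    fun i _ j _ hij => inj i j (rightCosetMk_eq_iff.1 hij), fun q hq => ?_⟩
  obtain ⟨k, hk, rfl⟩ := exists_eq_rightCosetMk_mul hq
  obtain ⟨i, hi⟩ := surj k hk
  exact ⟨i, trivial, rightCosetMk_eq_iff.2 hi⟩

theorem exists_isTransversal_mul (H : Subgroup G) (g : G) :
    ∃ k : rightCosetsIn H g → G, (∀ q, k q ∈ H) ∧ IsTransversal H g fun q => g * k q := by
  choose k hk hkq using fun q : rightCosetsIn H g => exists_eq_rightCosetMk_mul q.2
  refine ⟨k, hk, ?_⟩
  rw [IsTransversal, ← funext hkq]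
  exact ⟨fun q _ => q.2, Subtype.val_injective.injOn, fun q hq => ⟨⟨q, hq⟩, trivial, rfl⟩⟩

theorem isTransversal_unit (h : ∀ k ∈ H, g * k * g⁻¹ ∈ H) :
    IsTransversal H g fun _ : Unit => g :=
  .of_mul_inv_mem (fun _ => DoubleCoset.mem_doubleCoset_self H H g) (fun _ _ _ => rfl)
    fun k hk => ⟨(), h k hk⟩

theorem IsTransversal.numRightCosets_eq_card [Fintype ι] (ha : IsTransversal H g a) :
    numRightCosets H g = Fintype.card ι := by
  rw [numRightCosets, ← ha.ncard_eq, Set.ncard_univ, Nat.card_eq_fintype_card]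

/-- The characteristic function of the right coset `H g`. -/
noncomputable def rightCosetFun (H : Subgroup G) (g : G) : G → ℂ :=
  Set.indicator {x | x * g⁻¹ ∈ H} 1

theorem rightCosetFun_apply [DecidableEq (RightCosets H)] (g x : G) :
    rightCosetFun H g x = if rightCosetMk H g = rightCosetMk H x then 1 else 0 := by
  classical
  rw [rightCosetFun, Set.indicator_apply]
  exact if_congr rightCosetMk_eq_iff.symm rfl rfl

theorem rightCosetFun_mul_inv (g h x : G) :
    rightCosetFun H g (x * h⁻¹) = rightCosetFun H (g * h) x := by
  classical
  simp [rightCosetFun, Set.indicator_apply, mul_assoc]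

theorem IsTransversal.doubleCosetFun_eq_sum [Fintype ι] (ha : IsTransversal H g a) (x : G) :
    doubleCosetFun H g x = ∑ i, rightCosetFun H (a i) x := by
  classical
  simp only [rightCosetFun_apply]
  by_cases hx : x ∈ DoubleCoset.doubleCoset g H H
  · obtain ⟨i, -, hi : rightCosetMk H (a i) = rightCosetMk H x⟩ :=
      ha.surjOn (rightCosetMk_mem_rightCosetsIn.2 hx)
    rw [doubleCosetFun_apply_of_mem hx, Finset.sum_eq_single i, if_pos hi]
    · exact fun j _ hji => if_neg fun hj => hji (ha.injOn trivial trivial (hj.trans hi.symm))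
    · simp
  · rw [doubleCosetFun_apply_of_notMem hx, Finset.sum_eq_zero]
    exact fun i _ => if_neg fun hi =>
      hx (rightCosetMk_mem_rightCosetsIn.1 (by rw [← hi]; exact ha.mapsTo (Set.mem_univ i)))

theorem IsTransversal.conv_doubleCosetFun [Fintype ι] (ha : IsTransversal H g a)
    (f : HeckeAlgebra H) (x : G) :
    conv H f.1 (doubleCosetFun H g) x = ∑ i, f.1 (x * (a i)⁻¹) := by
  classical
  have hsupp (q : RightCosets H) : f.1 (x * q.out⁻¹) * doubleCosetFun H g q.out =
      Set.indicator (rightCosetsIn H g) (fun q => f.1 (x * q.out⁻¹)) q := by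
    have hq : q.out ∈ DoubleCoset.doubleCoset g H H ↔ q ∈ rightCosetsIn H g := by
      rw [← rightCosetMk_mem_rightCosetsIn, rightCosetMk, Quotient.out_eq]
    simp [doubleCosetFun, Set.indicator_apply, hq]
  rw [conv, finsum_congr hsupp, ← finsum_mem_def, ← finsum_eq_sum_of_fintype,
    ← finsum_mem_univ fun i => f.1 (x * (a i)⁻¹)]
  refine (finsum_mem_eq_of_bijOn _ ha fun i _ => ?_).symm
  obtain ⟨h, hh, hout⟩ := exists_out_eq (H := H) (a i)
  rw [hout, mul_inv_rev, ← mul_assoc, right_inv_of_mem f.2 _ (H.inv_mem hh)]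

theorem normalizedElem_apply {s : Finset (RightCosets H)} {x : G}
    (hs : (s : Set (RightCosets H)) = rightCosetsIn H x) (g : G) :
    (normalizedElem H g).1 x = (1 / (s.card : ℂ)) * ∑ q ∈ s, rightCosetFun H g q.out := by
  classical
  have hcard : numRightCosets H x = s.card := by
    rw [numRightCosets, ← hs, Set.ncard_coe_finset]
  have hmem : rightCosetMk H g ∈ s ↔ x ∈ DoubleCoset.doubleCoset g H H := by
    rw [← Finset.mem_coe, hs, rightCosetMk_mem_rightCosetsIn, mem_doubleCoset_comm]
  simp only [rightCosetFun_apply, rightCosetMk, Quotient.out_eq, Finset.sum_ite_eq]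
  rw [← hcard]
  by_cases hx : x ∈ DoubleCoset.doubleCoset g H H
  · rw [if_pos (hmem.2 hx), ← normalizedElem_congr hx]
    exact congrArg (1 / (numRightCosets H x : ℂ) * ·)
      (doubleCosetFun_apply_of_mem (DoubleCoset.mem_doubleCoset_self H H x))
  · rw [if_neg (mt hmem.1 hx), mul_zero]
    exact mul_eq_zero_of_right _ (doubleCosetFun_apply_of_notMem hx)

theorem eq_sum_normalizedElem [IsHeckePair H] [Fintype ι] (f : HeckeAlgebra H)
    (hf : ∀ x, f.1 x = ∑ i, rightCosetFun H (a i) x) :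
    f = ∑ i, normalizedElem H (a i) := by
  classical
  refine Subtype.ext <| funext fun x => ?_
  have hfin := IsHeckePair.finite_rightCosetsIn (H := H) x
  have hs : (hfin.toFinset : Set (RightCosets H)) = rightCosetsIn H x := hfin.coe_toFinset
  have hcard : (hfin.toFinset.card : ℂ) ≠ 0 := by
    rw [← Set.ncard_eq_toFinset_card _ hfin]
    exact Nat.cast_ne_zero.2 (numRightCosets_ne_zero x)
  have hconst : ∀ q ∈ hfin.toFinset, f.1 q.out = f.1 x := fun q hq =>
    apply_eq_of_mem_doubleCoset f <| rightCosetMk_mem_rightCosetsIn.1 <| by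
      rwa [rightCosetMk, Quotient.out_eq, ← hfin.mem_toFinset]
  calc f.1 x = (1 / (hfin.toFinset.card : ℂ)) * ∑ q ∈ hfin.toFinset, f.1 q.out := by
        rw [Finset.sum_congr rfl hconst, Finset.sum_const, nsmul_eq_mul,
          one_div, inv_mul_cancel_left₀ hcard]
    _ = ∑ i, (normalizedElem H (a i)).1 x := by
        simp only [normalizedElem_apply hs, hf, ← Finset.mul_sum]
        rw [Finset.sum_comm]
    _ = evalAt H x (∑ i, normalizedElem H (a i)) :=
        (map_sum (evalAt H x) (fun i => normalizedElem H (a i)) Finset.univ).symm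

theorem IsTransversal.normalizedElem_mul_normalizedElem [IsHeckePair H] [Fintype ι]
    (ha : IsTransversal H g a) (g' : G) :
    normalizedElem H g * normalizedElem H g' =
      (1 / (Fintype.card ι : ℂ)) • ∑ i, normalizedElem H (a i * g') := by
  obtain ⟨k, hk, hb⟩ := exists_isTransversal_mul H g'
  have := (IsHeckePair.finite_rightCosetsIn (H := H) g').fintype
  have hprod : doubleCosetElem H g * doubleCosetElem H g' =
      ∑ p : ι × rightCosetsIn H g', normalizedElem H (a p.1 * (g' * k p.2)) := by
    refine eq_sum_normalizedElem _ fun x => ?_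
    change conv H (doubleCosetElem H g).1 (doubleCosetFun H g') x = _
    rw [hb.conv_doubleCosetFun, Fintype.sum_prod_type_right]
    refine Finset.sum_congr rfl fun q _ => (ha.doubleCosetFun_eq_sum _).trans ?_
    exact Finset.sum_congr rfl fun i _ => rightCosetFun_mul_inv _ _ _
  simp only [← mul_assoc, normalizedElem_mul_right (hk _), Fintype.sum_prod_type, Finset.sum_const,
    Finset.card_univ, ← hb.numRightCosets_eq_card, ← Finset.smul_sum] at hprod
  rw [normalizedElem, normalizedElem, smul_mul_smul_comm, hprod, ha.numRightCosets_eq_card,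
    ← Nat.cast_smul_eq_nsmul ℂ, smul_smul, mul_assoc,
    one_div_mul_cancel (Nat.cast_ne_zero.2 (numRightCosets_ne_zero g')), mul_one]

theorem normalizedElem_one [IsHeckePair H] : normalizedElem H (1 : G) = 1 := by
  have hone : numRightCosets H (1 : G) = 1 := by
    simpa using (isTransversal_unit (H := H) (g := 1) (by simp)).numRightCosets_eq_card
  rw [normalizedElem, hone, doubleCosetElem_one, Nat.cast_one, div_one, one_smul]

theorem star_normalizedElem_of_inv_mem [IsHeckePair H]
    (hg : g⁻¹ ∈ DoubleCoset.doubleCoset g H H) :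
    star (normalizedElem H g) = normalizedElem H g := by
  rw [normalizedElem, star_smul, star_doubleCosetElem, doubleCosetElem_congr hg, star_div₀,
    star_one, star_natCast]

theorem IsTransversal.normalizedElem_mul_eq_of_forall_eq [IsHeckePair H] [Finite ι]
    (ha : IsTransversal H g a) {g' : G} {f : HeckeAlgebra H}
    (hf : ∀ i, normalizedElem H (a i * g') = f) :
    normalizedElem H g * normalizedElem H g' = f := by
  have := Fintype.ofFinite ι
  have hcard : (Fintype.card ι : ℂ) ≠ 0 := by
    rw [← ha.numRightCosets_eq_card]
    exact Nat.cast_ne_zero.2 (numRightCosets_ne_zero g)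
  rw [ha.normalizedElem_mul_normalizedElem, Finset.sum_congr rfl fun i _ => hf i,
    Finset.sum_const, Finset.card_univ, ← Nat.cast_smul_eq_nsmul ℂ, smul_smul,
    one_div_mul_cancel hcard, one_smul]

theorem normalizedElem_mul_of_conj_mem [IsHeckePair H] (h : ∀ k ∈ H, g * k * g⁻¹ ∈ H) (g' : G) :
    normalizedElem H g * normalizedElem H g' = normalizedElem H (g * g') :=
  (isTransversal_unit h).normalizedElem_mul_eq_of_forall_eq fun _ => rfl

end Transversals

end HeckePair

namespace NFHecke

/-! ### Matrices -/

section Elements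

variable {K : Type*} [Field K]

theorem cls_surjective : Function.Surjective (cls K) := Submodule.Quotient.mk_surjective _

theorem cls_zero : cls K 0 = 0 := rfl

theorem cls_add (x y : K) : cls K (x + y) = cls K x + cls K y := rfl

theorem cls_sub (x y : K) : cls K (x - y) = cls K x - cls K y := rfl

theorem units_smul_cls (u : (𝓞 K)ˣ) (x : K) :
    u • cls K x = cls K (algebraMap (𝓞 K) K u * x) := by
  rw [← Algebra.smul_def]
  rfl

theorem cls_eq_zero_iff {x : K} : cls K x = 0 ↔ ∃ c : 𝓞 K, algebraMap (𝓞 K) K c = x :=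
  Submodule.Quotient.mk_eq_zero _

theorem cls_algebraMap (c : 𝓞 K) : cls K (algebraMap (𝓞 K) K c) = 0 := cls_eq_zero_iff.2 ⟨c, rfl⟩

/-- The matrix `!![1, 0; 0, z]`. -/
def dil (z : Kˣ) : PK K := ⟨0, z⟩

/-- A unit of `𝓞`, as a unit of `K`. -/
noncomputable abbrev unitOfInt (u : (𝓞 K)ˣ) : Kˣ := Units.map (algebraMap (𝓞 K) K : 𝓞 K →* K) u

/-- A nonzero integer, as a unit of `K`. -/
noncomputable abbrev unitOfNonzero (a : (𝓞 K)⁰) : Kˣ := Units.mk0 (algebraMap (𝓞 K) K a) (by simp)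

/-- A unit of `𝓞`, as a nonzero integer. -/
def nonzeroOfUnit (u : (𝓞 K)ˣ) : (𝓞 K)⁰ := ⟨u, u.isUnit.mem_nonZeroDivisors⟩

theorem unitOfNonzero_nonzeroOfUnit (u : (𝓞 K)ˣ) :
    unitOfNonzero (nonzeroOfUnit u) = unitOfInt u := Units.ext rfl

theorem unitOfNonzero_mul (a b : (𝓞 K)⁰) :
    unitOfNonzero (a * b) = unitOfNonzero a * unitOfNonzero b :=
  Units.ext (map_mul (algebraMap (𝓞 K) K) _ _)

theorem diag_eq_dil (a : (𝓞 K)⁰) : diag a = dil (unitOfNonzero a) := rfl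

theorem unip_zero : unip (0 : K) = 1 := rfl

theorem unip_mul_unip (x y : K) : unip x * unip y = unip (x + y) := by
  ext
  · simp [unip, AxB.mul_y, add_comm]
  · simp [unip, AxB.mul_x]

theorem unip_inv (x : K) : (unip x)⁻¹ = unip (-x) := by
  rw [inv_eq_iff_mul_eq_one, unip_mul_unip, add_neg_cancel, unip_zero]

theorem dil_mul_dil (z w : Kˣ) : dil z * dil w = dil (z * w) := by
  ext
  · simp [dil, AxB.mul_y]
  · simp [dil, AxB.mul_x]

theorem dil_inv (z : Kˣ) : (dil z)⁻¹ = dil z⁻¹ := by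
  rw [inv_eq_iff_mul_eq_one, dil_mul_dil, mul_inv_cancel]
  rfl

theorem unip_mul_dil (x : K) (z : Kˣ) : unip x * dil z = dil z * unip (x * z) := by
  ext
  · simp [unip, dil, AxB.mul_y]
  · simp [unip, dil, AxB.mul_x]

theorem diag_mul (a b : (𝓞 K)⁰) : diag (a * b) = diag a * diag b := by
  simp only [diag_eq_dil, dil_mul_dil, unitOfNonzero_mul]

theorem diag_mul_unip_mul_inv (a : (𝓞 K)⁰) (x : K) :
    diag a * unip x * (diag a)⁻¹ = unip (x / algebraMap (𝓞 K) K a) := by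
  rw [mul_inv_eq_iff_eq_mul, diag_eq_dil, unip_mul_dil]
  simp

theorem exists_eq_dil_mul_unip {p : PK K} (hp : p ∈ PO K) :
    ∃ (u : (𝓞 K)ˣ) (c : 𝓞 K), p = dil (unitOfInt u) * unip (algebraMap (𝓞 K) K c) := by
  obtain ⟨⟨c, u⟩, rfl⟩ := hp
  refine ⟨u, c, ?_⟩
  ext
  · simp [unip, dil, AxB.map_y, AxB.mul_y]
  · simp [unip, dil, AxB.map_x, AxB.mul_x]

theorem unip_mem_PO_iff {x : K} : unip x ∈ PO K ↔ cls K x = 0 := by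
  rw [cls_eq_zero_iff]
  constructor
  · rintro ⟨⟨c, u⟩, h⟩
    exact ⟨c, congrArg AxB.y h⟩
  · rintro ⟨c, rfl⟩
    exact ⟨⟨c, 1⟩, AxB.ext rfl (map_one _)⟩

theorem unip_algebraMap_mem_PO (c : 𝓞 K) : unip (algebraMap (𝓞 K) K c) ∈ PO K :=
  unip_mem_PO_iff.2 (cls_algebraMap c)

theorem unip_div_mem_PO_iff {a : (𝓞 K)⁰} {c : 𝓞 K} :
    unip (algebraMap (𝓞 K) K c / algebraMap (𝓞 K) K a) ∈ PO K ↔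
      c ∈ Ideal.span {(a : 𝓞 K)} := by
  have ha : algebraMap (𝓞 K) K a ≠ 0 := by simp
  rw [unip_mem_PO_iff, cls_eq_zero_iff, Ideal.mem_span_singleton, dvd_def]
  refine exists_congr fun e => ?_
  rw [eq_div_iff ha, ← map_mul, (FaithfulSMul.algebraMap_injective (𝓞 K) K).eq_iff, mul_comm,
    eq_comm]

theorem dil_unitOfInt_mem_PO (u : (𝓞 K)ˣ) : dil (unitOfInt u) ∈ PO K :=
  ⟨⟨0, u⟩, AxB.ext (map_zero _) rfl⟩

theorem unip_units_mul (u : (𝓞 K)ˣ) (x : K) :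
    unip (algebraMap (𝓞 K) K u * x) = (dil (unitOfInt u))⁻¹ * unip x * dil (unitOfInt u) := by
  rw [mul_assoc, unip_mul_dil, inv_mul_cancel_left, mul_comm]
  rfl

end Elements

/-! ### The relations -/

open HeckePair MulAction

section HeckeElements

variable {K : Type*} [Field K]

theorem ofQuotientStabilizer_cls (x : K) (q : (𝓞 K)ˣ ⧸ stabilizer (𝓞 K)ˣ (cls K x)) :
    ofQuotientStabilizer (𝓞 K)ˣ (cls K x) q = cls K (algebraMap (𝓞 K) K q.out * x) := by
  conv_lhs => rw [← QuotientGroup.out_eq' q]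
  rw [← units_smul_cls]
  rfl

theorem isTransversal_unip (x : K) :
    IsTransversal (PO K) (unip x) fun q : (𝓞 K)ˣ ⧸ stabilizer (𝓞 K)ˣ (cls K x) =>
      unip (algebraMap (𝓞 K) K q.out * x) := by
  refine .of_mul_inv_mem (fun q => ?_) (fun p q h => ?_) fun k hk => ?_
  · rw [unip_units_mul]
    exact mul_mem_doubleCoset ((PO K).inv_mem (dil_unitOfInt_mem_PO _)) (dil_unitOfInt_mem_PO _)
  · rw [unip_inv, unip_mul_unip, unip_mem_PO_iff, ← sub_eq_add_neg, cls_sub,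
      ← ofQuotientStabilizer_cls, ← ofQuotientStabilizer_cls, sub_eq_zero] at h
    exact (injective_ofQuotientStabilizer _ _ h).symm
  · obtain ⟨u, c, rfl⟩ := exists_eq_dil_mul_unip hk
    refine ⟨QuotientGroup.mk u, ?_⟩
    rw [← mul_assoc, unip_mul_dil, unip_inv, mul_assoc, mul_assoc, unip_mul_unip, unip_mul_unip]
    refine (PO K).mul_mem (dil_unitOfInt_mem_PO u) (unip_mem_PO_iff.2 ?_)
    rw [← sub_eq_add_neg, cls_add, cls_sub, cls_algebraMap, zero_sub, ← sub_eq_add_neg,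
      sub_eq_zero, ← ofQuotientStabilizer_cls, mul_comm]
    exact (units_smul_cls u x).symm

theorem isTransversal_diag (a : (𝓞 K)⁰) :
    IsTransversal (PO K) (diag a) fun b : 𝓞 K ⧸ Ideal.span {(a : 𝓞 K)} =>
      diag a * unip (algebraMap (𝓞 K) K b.out) := by
  have hconj (c d : 𝓞 K) : diag a * unip (algebraMap (𝓞 K) K c) *
      (diag a * unip (algebraMap (𝓞 K) K d))⁻¹ =
        unip (algebraMap (𝓞 K) K (c - d) / algebraMap (𝓞 K) K a) := by
    rw [← diag_mul_unip_mul_inv, map_sub, sub_eq_add_neg, ← unip_mul_unip, ← unip_inv]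
    group
  refine .of_mul_inv_mem (fun b => ?_) (fun b b' h => ?_) fun k hk => ?_
  · simpa using mul_mem_doubleCoset (PO K).one_mem (unip_algebraMap_mem_PO b.out)
  · rw [hconj, unip_div_mem_PO_iff, ← Ideal.Quotient.mk_eq_mk_iff_sub_mem] at h
    simpa using h.symm
  · obtain ⟨u, c, rfl⟩ := exists_eq_dil_mul_unip hk
    refine ⟨Ideal.Quotient.mk _ c, ?_⟩
    rw [← mul_assoc, diag_eq_dil, dil_mul_dil, mul_comm, ← dil_mul_dil, ← diag_eq_dil, mul_assoc,
      mul_assoc, ← mul_assoc (diag a), hconj]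
    refine (PO K).mul_mem (dil_unitOfInt_mem_PO u) (unip_div_mem_PO_iff.2 ?_)
    rw [← Ideal.Quotient.mk_eq_mk_iff_sub_mem]
    exact (Quotient.out_eq _).symm

theorem inv_diag_conj_mem_PO (a : (𝓞 K)⁰) {k : PK K} (hk : k ∈ PO K) :
    (diag a)⁻¹ * k * (diag a)⁻¹⁻¹ ∈ PO K := by
  obtain ⟨u, c, rfl⟩ := exists_eq_dil_mul_unip hk
  have hconj : (diag a)⁻¹ * (dil (unitOfInt u) * unip (algebraMap (𝓞 K) K c)) * (diag a)⁻¹⁻¹ =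
      dil (unitOfInt u) * unip (algebraMap (𝓞 K) K (c * a)) := by
    rw [inv_inv, diag_eq_dil, mul_assoc, mul_assoc, unip_mul_dil, ← mul_assoc, ← mul_assoc,
      dil_inv, dil_mul_dil, dil_mul_dil, mul_right_comm, inv_mul_cancel, one_mul, map_mul]
    rfl
  rw [hconj]
  exact (PO K).mul_mem (dil_unitOfInt_mem_PO u) (unip_algebraMap_mem_PO _)

/-- The complex number `√N_a`. -/
noncomputable def sqrtN (a : (𝓞 K)⁰) : ℂ := (Real.sqrt (normN a) : ℝ)

theorem sqrtN_mul_self (a : (𝓞 K)⁰) : sqrtN a * sqrtN a = normN a := by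
  rw [sqrtN, ← Complex.ofReal_mul, Real.mul_self_sqrt (Nat.cast_nonneg _), Complex.ofReal_natCast]

theorem star_sqrtN (a : (𝓞 K)⁰) : star (sqrtN a) = sqrtN a := Complex.conj_ofReal _

end HeckeElements

section Relations

variable {K : Type*} [Field K] [NumberField K]

theorem theta_cls (x : K) : theta (cls K x) = normalizedElem (PO K) (unip x) := rfl

theorem numR_eq_card (r : KModO K) :
    numR r = Fintype.card ((𝓞 K)ˣ ⧸ stabilizer (𝓞 K)ˣ r) := by
  obtain ⟨x, rfl⟩ := cls_surjective r
  exact (isTransversal_unip x).numRightCosets_eq_card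

theorem numRightCosets_diag (a : (𝓞 K)⁰) : numRightCosets (PO K) (diag a) = normN a := by
  rw [(isTransversal_diag a).numRightCosets_eq_card, normN, Nat.card_eq_fintype_card]

theorem normN_ne_zero (a : (𝓞 K)⁰) : normN a ≠ 0 :=
  numRightCosets_diag a ▸ numRightCosets_ne_zero _

theorem normN_eq_absNorm (a : (𝓞 K)⁰) : normN a = Ideal.absNorm (Ideal.span {(a : 𝓞 K)}) := rfl

theorem sqrtN_ne_zero (a : (𝓞 K)⁰) : sqrtN a ≠ 0 :=
  Complex.ofReal_ne_zero.2 (Real.sqrt_ne_zero'.2 (by exact_mod_cast (normN_ne_zero a).bot_lt))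

theorem sqrtN_mul (a b : (𝓞 K)⁰) : sqrtN (a * b) = sqrtN a * sqrtN b := by
  simp [sqrtN, normN_eq_absNorm, ← Ideal.span_singleton_mul_span_singleton]

theorem mu_eq_smul_normalizedElem (a : (𝓞 K)⁰) :
    mu a = sqrtN a • normalizedElem (PO K) (diag a) := by
  rw [mu, doubleCosetElem_eq_smul_normalizedElem, numRightCosets_diag, smul_smul]
  congr 1
  rw [Complex.ofReal_div, Complex.ofReal_one, ← sqrtN, ← sqrtN_mul_self, one_div,
    inv_mul_cancel_left₀ (sqrtN_ne_zero a)]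

theorem star_mu_eq_smul_normalizedElem (a : (𝓞 K)⁰) :
    star (mu a) = (1 / sqrtN a) • normalizedElem (PO K) (diag a)⁻¹ := by
  have hone : numRightCosets (PO K) (diag a)⁻¹ = 1 := by
    simpa using
      (isTransversal_unit fun _ => inv_diag_conj_mem_PO a).numRightCosets_eq_card
  rw [mu, star_smul, star_doubleCosetElem, doubleCosetElem_eq_smul_normalizedElem, hone,
    Nat.cast_one, one_smul, Complex.ofReal_div, Complex.ofReal_one, ← sqrtN, star_div₀, star_one,
    star_sqrtN]

theorem theta_mul_normalizedElem_dil (x : K) (z : Kˣ) :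
    theta (cls K x) * normalizedElem (PO K) (dil z) = normalizedElem (PO K) (unip x * dil z) := by
  have hconj (u : (𝓞 K)ˣ) : normalizedElem (PO K) (unip (algebraMap (𝓞 K) K u * x) * dil z) =
      normalizedElem (PO K) (unip x * dil z) := by
    rw [unip_units_mul, mul_assoc, mul_assoc, dil_mul_dil, mul_comm _ z, ← dil_mul_dil,
      normalizedElem_mul_left ((PO K).inv_mem (dil_unitOfInt_mem_PO u)), ← mul_assoc,
      normalizedElem_mul_right (dil_unitOfInt_mem_PO u)]
  exact (isTransversal_unip x).normalizedElem_mul_eq_of_forall_eq fun q => hconj q.out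

theorem normalizedElem_inv_diag_mul (a : (𝓞 K)⁰) (p : PK K) :
    normalizedElem (PO K) (diag a)⁻¹ * normalizedElem (PO K) p =
      normalizedElem (PO K) ((diag a)⁻¹ * p) :=
  normalizedElem_mul_of_conj_mem (fun _ => inv_diag_conj_mem_PO a) p

theorem mu_of_isUnit {a : (𝓞 K)⁰} (ha : IsUnit (a : 𝓞 K)) : mu a = 1 := by
  have hnorm : normN a = 1 := by
    rw [normN_eq_absNorm, Ideal.span_singleton_eq_top.2 ha, ← Ideal.one_eq_top, map_one]
  have hdiag : diag a = 1 * dil (unitOfInt ha.unit) := by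
    rw [one_mul]
    exact AxB.ext rfl (Units.ext rfl)
  rw [mu_eq_smul_normalizedElem, hdiag, normalizedElem_mul_right (dil_unitOfInt_mem_PO _),
    normalizedElem_one, sqrtN, hnorm]
  simp

theorem star_mu_mul_mu (a : (𝓞 K)⁰) : star (mu a) * mu a = 1 := by
  rw [star_mu_eq_smul_normalizedElem, mu_eq_smul_normalizedElem, smul_mul_smul_comm,
    one_div_mul_cancel (sqrtN_ne_zero a), one_smul, normalizedElem_inv_diag_mul, inv_mul_cancel,
    normalizedElem_one]

theorem mu_mul_mu (a b : (𝓞 K)⁰) : mu a * mu b = mu (a * b) := by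
  have hprod : normalizedElem (PO K) (diag a) * normalizedElem (PO K) (diag b) =
      normalizedElem (PO K) (diag (a * b)) := by
    refine (isTransversal_diag a).normalizedElem_mul_eq_of_forall_eq fun c => ?_
    rw [mul_assoc, diag_eq_dil b, unip_mul_dil, ← mul_assoc, ← diag_eq_dil, ← diag_mul]
    exact normalizedElem_mul_right
      (by simpa using unip_algebraMap_mem_PO (c.out * (b : 𝓞 K))) _
  simp only [mu_eq_smul_normalizedElem, smul_mul_smul_comm, hprod, sqrtN_mul]

theorem theta_units_smul (r : KModO K) (w : (𝓞 K)ˣ) : theta (w • r) = theta r := by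
  obtain ⟨x, rfl⟩ := cls_surjective r
  rw [units_smul_cls, theta_cls, unip_units_mul,
    normalizedElem_mul_right (dil_unitOfInt_mem_PO w),
    normalizedElem_mul_left ((PO K).inv_mem (dil_unitOfInt_mem_PO w)), theta_cls]

theorem star_theta (r : KModO K) : star (theta r) = theta r := by
  obtain ⟨x, rfl⟩ := cls_surjective r
  refine star_normalizedElem_of_inv_mem ?_
  have hneg : (unip x)⁻¹ = unip (algebraMap (𝓞 K) K ((-1 : (𝓞 K)ˣ) : 𝓞 K) * x) := by
    simp [unip_inv]
  rw [hneg, unip_units_mul]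
  exact mul_mem_doubleCoset ((PO K).inv_mem (dil_unitOfInt_mem_PO _)) (dil_unitOfInt_mem_PO _)

theorem theta_mul_theta_eq_average (r s : KModO K) : theta r * theta s =
    (1 / (numR r : ℂ)) • ∑ u : (𝓞 K)ˣ ⧸ stabilizer (𝓞 K)ˣ r,
      theta (ofQuotientStabilizer (𝓞 K)ˣ r u + s) := by
  obtain ⟨x, rfl⟩ := cls_surjective r
  obtain ⟨y, rfl⟩ := cls_surjective s
  rw [numR_eq_card]
  refine ((isTransversal_unip x).normalizedElem_mul_normalizedElem (unip y)).trans ?_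
  simp only [unip_mul_unip, ofQuotientStabilizer_cls, ← cls_add, theta_cls]

theorem theta_mul_theta (r s : KModO K) : theta r * theta s =
    ((1 / (numR r : ℂ)) * (1 / (numR s : ℂ))) •
      ∑ u : (𝓞 K)ˣ ⧸ stabilizer (𝓞 K)ˣ r, ∑ v : (𝓞 K)ˣ ⧸ stabilizer (𝓞 K)ˣ s,
        theta (ofQuotientStabilizer (𝓞 K)ˣ r u + ofQuotientStabilizer (𝓞 K)ˣ s v) := by
  have htheta (v : (𝓞 K)ˣ ⧸ stabilizer (𝓞 K)ˣ s) :
      theta (ofQuotientStabilizer (𝓞 K)ˣ s v) = theta s := by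
    induction v using QuotientGroup.induction_on with
    | H w => exact theta_units_smul s w
  have hcard : (numR s : ℂ) ≠ 0 := by simp [numR_eq_card]
  rw [Finset.sum_comm, mul_comm (1 / _), ← smul_smul, Finset.smul_sum]
  simp only [← theta_mul_theta_eq_average, htheta]
  rw [Finset.sum_const, Finset.card_univ, ← numR_eq_card, ← Nat.cast_smul_eq_nsmul ℂ, smul_smul,
    one_div_mul_cancel hcard, one_smul]

theorem mu_mul_theta_mul_star_mu (a : (𝓞 K)⁰) (x : K) : mu a * theta (cls K x) * star (mu a) =
    (1 / (normN a : ℂ)) • ∑ b : 𝓞 K ⧸ Ideal.span {(a : 𝓞 K)}, theta (divClass a x b) := by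
  have hdiv (b : 𝓞 K ⧸ Ideal.span {(a : 𝓞 K)}) :
      normalizedElem (PO K) (diag a * unip (algebraMap (𝓞 K) K b.out) * (unip x * (diag a)⁻¹)) =
        theta (divClass a x b) := by
    conv_rhs => rw [← Quotient.out_eq b]
    rw [mul_assoc, ← mul_assoc (unip _), unip_mul_unip, ← mul_assoc, diag_mul_unip_mul_inv,
      add_comm]
    rfl
  rw [star_mu_eq_smul_normalizedElem, mu_eq_smul_normalizedElem, smul_mul_assoc,
    smul_mul_smul_comm, mul_one_div_cancel (sqrtN_ne_zero a), one_smul, mul_assoc, diag_eq_dil,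
    dil_inv, theta_mul_normalizedElem_dil, ← dil_inv, ← diag_eq_dil,
    (isTransversal_diag a).normalizedElem_mul_normalizedElem]
  simp only [hdiv, normN, Nat.card_eq_fintype_card]

theorem relations_mu_theta : Relations (mu (K := K)) theta where
  mu_unit _ := mu_of_isUnit
  star_mu_mul_mu := star_mu_mul_mu
  mu_mul := mu_mul_mu
  theta_zero := normalizedElem_one
  theta_smul := theta_units_smul
  star_theta := star_theta
  theta_mul := theta_mul_theta
  mu_theta_star_mu := mu_mul_theta_mul_star_mu

end Relations

/-! ### Averages over orbits -/

section OrbitAverages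

open Finset

variable {G X : Type*} [Group G] [MulAction G X] {S : Finset X}

theorem sum_ofQuotientStabilizer_eq_sum_filter [DecidableRel (orbitRel G X)] {M : Type*}
    [AddCommMonoid M] (hS : ∀ (g : G), ∀ s ∈ S, g • s ∈ S) {s : X} (hs : s ∈ S)
    [Fintype (G ⧸ stabilizer G s)] (F : X → M) :
    ∑ u, F (ofQuotientStabilizer G s u) = ∑ s' ∈ S with orbitRel G X s' s, F s' := by
  refine Finset.sum_bij (fun u _ => ofQuotientStabilizer G s u) (fun u _ => ?_)
    (fun u _ v _ h => injective_ofQuotientStabilizer G s h) (fun s' hs' => ?_) fun _ _ => rfl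
  · induction u using QuotientGroup.induction_on with
    | H g => exact Finset.mem_filter.2 ⟨hS g s hs, g, rfl⟩
  · obtain ⟨g, hg⟩ := (Finset.mem_filter.1 hs').2
    exact ⟨QuotientGroup.mk g, Finset.mem_univ _, hg⟩

theorem sum_average_rel_eq_sum {r : Setoid X} [DecidableRel r] {𝕜 M : Type*} [DivisionRing 𝕜]
    [CharZero 𝕜] [AddCommMonoid M] [Module 𝕜 M] (S : Finset X) (F : X → M) :
    ∑ s ∈ S, (1 / (#{s' ∈ S | r s' s} : 𝕜)) • ∑ s' ∈ S with r s' s, F s' = ∑ s ∈ S, F s := by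
  simp only [Finset.sum_filter, Finset.smul_sum]
  rw [Finset.sum_comm]
  refine Finset.sum_congr rfl fun s hs => ?_
  have hclass : ∀ s' ∈ S, (1 / (#{s'' ∈ S | r s'' s'} : 𝕜)) • (if r s s' then F s else 0) =
      if r s' s then (1 / (#{s'' ∈ S | r s'' s} : 𝕜)) • F s else 0 := by
    intro s' _
    by_cases h : r s s'
    · have hiff (s'' : X) : r s'' s' ↔ r s'' s :=
        ⟨fun h' => r.trans h' (r.symm h), fun h' => r.trans h' h⟩
      rw [if_pos h, if_pos (r.symm h)]
      simp only [hiff]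
    · rw [if_neg h, if_neg (mt r.symm h), smul_zero]
  have hcard : (#{s' ∈ S | r s' s} : 𝕜) ≠ 0 :=
    Nat.cast_ne_zero.2 (Finset.card_ne_zero_of_mem (Finset.mem_filter.2 ⟨hs, r.refl s⟩))
  rw [Finset.sum_congr rfl hclass, ← Finset.sum_filter, Finset.sum_const,
    ← Nat.cast_smul_eq_nsmul 𝕜, smul_smul, mul_one_div_cancel hcard, one_smul]

theorem sum_orbit_average_eq_sum {𝕜 M : Type*} [DivisionRing 𝕜] [CharZero 𝕜] [AddCommMonoid M]
    [Module 𝕜 M] [∀ s : X, Fintype (G ⧸ stabilizer G s)] (hS : ∀ (g : G), ∀ s ∈ S, g • s ∈ S)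
    (F : X → M) :
    ∑ s ∈ S, (1 / (Fintype.card (G ⧸ stabilizer G s) : 𝕜)) • ∑ u, F (ofQuotientStabilizer G s u) =
      ∑ s ∈ S, F s := by
  classical
  rw [← sum_average_rel_eq_sum (r := orbitRel G X) (𝕜 := 𝕜) S F]
  refine Finset.sum_congr rfl fun s hs => ?_
  have hcard : Fintype.card (G ⧸ stabilizer G s) = #{s' ∈ S | orbitRel G X s' s} := by
    rw [← Finset.card_univ, Finset.card_eq_sum_ones, Finset.card_eq_sum_ones]
    exact sum_ofQuotientStabilizer_eq_sum_filter hS hs fun _ => 1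
  rw [hcard, sum_ofQuotientStabilizer_eq_sum_filter hS hs]

end OrbitAverages

/-! ### Consequences of the relations -/

section DivClass

variable {K : Type*} [Field K]

theorem divClass_injective (a : (𝓞 K)⁰) (x : K) : Function.Injective (divClass a x) := by
  intro b b' h
  obtain ⟨c, rfl⟩ := Ideal.Quotient.mk_surjective b
  obtain ⟨c', rfl⟩ := Ideal.Quotient.mk_surjective b'
  have hcls : cls K ((x + algebraMap (𝓞 K) K c) / algebraMap (𝓞 K) K a) =
      cls K ((x + algebraMap (𝓞 K) K c') / algebraMap (𝓞 K) K a) := h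
  rw [← sub_eq_zero, ← cls_sub, ← sub_div, add_sub_add_left_eq_sub, ← map_sub, ← unip_mem_PO_iff,
    unip_div_mem_PO_iff] at hcls
  exact (Ideal.Quotient.mk_eq_mk_iff_sub_mem _ _).2 hcls

theorem divClass_mul (a : (𝓞 K)⁰) (x : K) (b : 𝓞 K ⧸ Ideal.span {(a : 𝓞 K)}) :
    divClass a (algebraMap (𝓞 K) K a * x) b = cls K x + divClass a 0 b := by
  obtain ⟨c, rfl⟩ := Ideal.Quotient.mk_surjective b
  have ha : algebraMap (𝓞 K) K a ≠ 0 := by simp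
  change cls K ((algebraMap (𝓞 K) K a * x + algebraMap (𝓞 K) K c) / algebraMap (𝓞 K) K a) =
    cls K x + cls K ((0 + algebraMap (𝓞 K) K c) / algebraMap (𝓞 K) K a)
  rw [← cls_add, zero_add, add_div, mul_div_cancel_left₀ _ ha]

theorem units_smul_divClass (u : (𝓞 K)ˣ) (a : (𝓞 K)⁰) (c : 𝓞 K) :
    u • divClass a 0 (Ideal.Quotient.mk _ c) = divClass a 0 (Ideal.Quotient.mk _ (u * c)) := by
  change u • cls K ((0 + algebraMap (𝓞 K) K c) / algebraMap (𝓞 K) K a) =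
    cls K ((0 + algebraMap (𝓞 K) K (u * c)) / algebraMap (𝓞 K) K a)
  rw [units_smul_cls, zero_add, zero_add, map_mul, mul_div_assoc]

end DivClass

namespace Relations

variable {K A : Type*} [Field K] [NumberField K] [Ring A] [StarRing A] [Algebra ℂ A]
  {m : (𝓞 K)⁰ → A} {t : KModO K → A} (h : Relations m t)
include h

theorem sum_theta_smul_add_ofQuotientStabilizer (w : (𝓞 K)ˣ) (r s : KModO K) :
    ∑ v : (𝓞 K)ˣ ⧸ stabilizer (𝓞 K)ˣ s, t (w • r + ofQuotientStabilizer (𝓞 K)ˣ s v) =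
      ∑ v : (𝓞 K)ˣ ⧸ stabilizer (𝓞 K)ˣ s, t (r + ofQuotientStabilizer (𝓞 K)ˣ s v) := by
  rw [← Equiv.sum_comp (MulAction.toPerm w)]
  refine Finset.sum_congr rfl fun v _ => ?_
  rw [MulAction.toPerm_apply, ofQuotientStabilizer_smul, ← smul_add, h.theta_smul]

theorem theta_mul_theta_eq_average (r s : KModO K) : t r * t s =
    (1 / (numR s : ℂ)) • ∑ v : (𝓞 K)ˣ ⧸ stabilizer (𝓞 K)ˣ s,
      t (r + ofQuotientStabilizer (𝓞 K)ˣ s v) := by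
  have hconst (u : (𝓞 K)ˣ ⧸ stabilizer (𝓞 K)ˣ r) :
      ∑ v, t (ofQuotientStabilizer (𝓞 K)ˣ r u + ofQuotientStabilizer (𝓞 K)ˣ s v) =
        ∑ v, t (r + ofQuotientStabilizer (𝓞 K)ˣ s v) := by
    induction u using QuotientGroup.induction_on with
    | H w => exact h.sum_theta_smul_add_ofQuotientStabilizer w r s
  have hcard : (numR r : ℂ) ≠ 0 := by simp [numR_eq_card]
  rw [h.theta_mul, Finset.sum_congr rfl fun u _ => hconst u, Finset.sum_const, Finset.card_univ,
    ← numR_eq_card, ← Nat.cast_smul_eq_nsmul ℂ, smul_smul, mul_right_comm,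
    one_div_mul_cancel hcard, one_mul]

theorem theta_mul_sum_theta (r : KModO K) {S : Finset (KModO K)}
    (hS : ∀ (w : (𝓞 K)ˣ), ∀ s ∈ S, w • s ∈ S) :
    t r * ∑ s ∈ S, t s = ∑ s ∈ S, t (r + s) := by
  simp only [Finset.mul_sum, h.theta_mul_theta_eq_average, numR_eq_card]
  exact sum_orbit_average_eq_sum hS fun s => t (r + s)

theorem theta_mul_sum_theta_divClass (r : KModO K) (a : (𝓞 K)⁰) :
    t r * ∑ b, t (divClass a 0 b) = ∑ b, t (r + divClass a 0 b) := by
  have hsum := h.theta_mul_sum_theta r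
    (S := Finset.univ.map ⟨divClass a 0, divClass_injective a 0⟩) fun w s hs => by
      obtain ⟨b, -, rfl⟩ := Finset.mem_map.1 hs
      obtain ⟨c, rfl⟩ := Ideal.Quotient.mk_surjective b
      exact Finset.mem_map.2 ⟨Ideal.Quotient.mk _ (w * c), Finset.mem_univ _,
        (units_smul_divClass w a c).symm⟩
  simpa only [Finset.sum_map, Function.Embedding.coeFn_mk] using hsum

theorem mu_mul_star_mu (a : (𝓞 K)⁰) :
    m a * star (m a) = (1 / (normN a : ℂ)) • ∑ b, t (divClass a 0 b) := by
  simpa only [cls_zero, h.theta_zero, mul_one] using h.mu_theta_star_mu a 0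

theorem theta_mul_mu_mul_star_mu (a : (𝓞 K)⁰) (x : K) : t (cls K x) * (m a * star (m a)) =
    m a * t (cls K (algebraMap (𝓞 K) K a * x)) * star (m a) := by
  rw [h.mu_mul_star_mu, h.mu_theta_star_mu, mul_smul_comm, h.theta_mul_sum_theta_divClass]
  simp only [divClass_mul]

theorem theta_mul_mu (a : (𝓞 K)⁰) (x : K) :
    t (cls K x) * m a = m a * t (cls K (algebraMap (𝓞 K) K a * x)) := by
  simpa only [mul_assoc, h.star_mu_mul_mu, mul_one] using
    congrArg (· * m a) (h.theta_mul_mu_mul_star_mu a x)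

theorem star_mu_mul_theta (a : (𝓞 K)⁰) (x : K) :
    star (m a) * t (cls K x) = t (cls K (algebraMap (𝓞 K) K a * x)) * star (m a) := by
  simpa only [star_mul, h.star_theta] using congrArg star (h.theta_mul_mu a x)

theorem theta_add_div_mul_mu (x : K) (c : 𝓞 K) (b : (𝓞 K)⁰) :
    t (cls K (x + algebraMap (𝓞 K) K c / algebraMap (𝓞 K) K b)) * m b = t (cls K x) * m b := by
  have hb : algebraMap (𝓞 K) K b ≠ 0 := by simp
  rw [h.theta_mul_mu, h.theta_mul_mu, mul_add, mul_div_cancel₀ _ hb, cls_add, cls_algebraMap,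
    add_zero]

theorem star_mu_mul_theta_add_div (a : (𝓞 K)⁰) (x : K) (c : 𝓞 K) :
    star (m a) * t (cls K (x + algebraMap (𝓞 K) K c / algebraMap (𝓞 K) K a)) =
      star (m a) * t (cls K x) := by
  simpa only [star_mul, h.star_theta] using congrArg star (h.theta_add_div_mul_mu x c a)

theorem star_mu_mul_theta_mul_mu_mul (c a b : (𝓞 K)⁰) (x : K) :
    star (m (c * a)) * t (cls K x) * m (c * b) =
      star (m a) * t (cls K (algebraMap (𝓞 K) K c * x)) * m b :=
  calc
    _ = star (m a) * (star (m c) * t (cls K x)) * (m c * m b) := by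
      simp only [← h.mu_mul, star_mul, mul_assoc]
    _ = star (m a) * t (cls K (algebraMap (𝓞 K) K c * x)) * (star (m c) * m c) * m b := by
      rw [h.star_mu_mul_theta]
      simp only [mul_assoc]
    _ = _ := by rw [h.star_mu_mul_mu, mul_one]

theorem mu_one : m 1 = 1 := h.mu_unit 1 isUnit_one

theorem mu_nonzeroOfUnit_mul (u : (𝓞 K)ˣ) (b : (𝓞 K)⁰) : m (nonzeroOfUnit u * b) = m b := by
  rw [← h.mu_mul, h.mu_unit _ u.isUnit, one_mul]

end Relations

/-! ### Monomials -/

section MonomialRep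

variable {K : Type*} [Field K]

/-- The matrix `!![1, x * b; 0, b / a]`, whose double coset supports `μ_a^* θ_x μ_b`. -/
noncomputable def monomialRep (a : (𝓞 K)⁰) (x : K) (b : (𝓞 K)⁰) : PK K :=
  (diag a)⁻¹ * unip x * diag b

theorem monomialRep_eq_dil_mul_unip (a : (𝓞 K)⁰) (x : K) (b : (𝓞 K)⁰) :
    monomialRep a x b =
      dil (unitOfNonzero b / unitOfNonzero a) * unip (x * algebraMap (𝓞 K) K b) := by
  rw [monomialRep, diag_eq_dil, diag_eq_dil, mul_assoc, unip_mul_dil, ← mul_assoc, dil_inv,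
    dil_mul_dil, inv_mul_eq_div]
  rfl

theorem exists_monomialRep_eq [NumberField K] (p : PK K) : ∃ a x b, monomialRep a x b = p := by
  obtain ⟨b, a, ha, hx⟩ := IsFractionRing.div_surjective (A := 𝓞 K) (p.x : K)
  have hb : algebraMap (𝓞 K) K b ≠ 0 := fun h => p.x.ne_zero (by rw [← hx, h, zero_div])
  refine ⟨⟨a, ha⟩, p.y / algebraMap (𝓞 K) K b,
    ⟨b, mem_nonZeroDivisors_of_ne_zero fun h => hb (by rw [h, map_zero])⟩, ?_⟩
  rw [monomialRep_eq_dil_mul_unip]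
  ext
  · simp [dil, unip, AxB.mul_y, hb]
  · simp [dil, unip, AxB.mul_x, ← hx]

theorem monomialRep_eq_iff {a b a' b' : (𝓞 K)⁰} {x x' : K} :
    monomialRep a x b = monomialRep a' x' b' ↔
      b * a' = b' * a ∧ x * algebraMap (𝓞 K) K b = x' * algebraMap (𝓞 K) K b' := by
  have hx : unitOfNonzero b / unitOfNonzero a = unitOfNonzero b' / unitOfNonzero a' ↔
      b * a' = b' * a := by
    rw [div_eq_div_iff_mul_eq_mul, ← unitOfNonzero_mul, ← unitOfNonzero_mul, Units.ext_iff]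
    exact (FaithfulSMul.algebraMap_injective (𝓞 K) K).eq_iff.trans Subtype.ext_iff.symm
  rw [monomialRep_eq_dil_mul_unip, monomialRep_eq_dil_mul_unip, AxB.ext_iff, ← hx]
  simp [dil, unip, AxB.mul_y, AxB.mul_x, and_comm]

theorem dil_mul_monomialRep (u : (𝓞 K)ˣ) (a : (𝓞 K)⁰) (x : K) (b : (𝓞 K)⁰) :
    dil (unitOfInt u) * monomialRep a (algebraMap (𝓞 K) K u * x) b =
      monomialRep a x (nonzeroOfUnit u * b) := by
  rw [monomialRep_eq_dil_mul_unip, monomialRep_eq_dil_mul_unip, ← mul_assoc, dil_mul_dil,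
    unitOfNonzero_mul, unitOfNonzero_nonzeroOfUnit, mul_div_assoc, mul_comm _ x, mul_assoc x]
  rfl

theorem unip_mul_monomialRep (c : 𝓞 K) (a : (𝓞 K)⁰) (x : K) (b : (𝓞 K)⁰) :
    unip (algebraMap (𝓞 K) K c) * monomialRep a x b =
      monomialRep a (x + algebraMap (𝓞 K) K c / algebraMap (𝓞 K) K a) b := by
  rw [monomialRep, monomialRep, add_comm, ← unip_mul_unip, ← diag_mul_unip_mul_inv]
  group

theorem monomialRep_mul_dil (a : (𝓞 K)⁰) (x : K) (b : (𝓞 K)⁰) (u : (𝓞 K)ˣ) :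
    monomialRep a x b * dil (unitOfInt u) = monomialRep a x (nonzeroOfUnit u * b) := by
  rw [monomialRep, monomialRep, mul_assoc, mul_comm _ b, diag_mul,
    diag_eq_dil (nonzeroOfUnit u), unitOfNonzero_nonzeroOfUnit]

theorem monomialRep_mul_unip (a : (𝓞 K)⁰) (x : K) (b : (𝓞 K)⁰) (c : 𝓞 K) :
    monomialRep a x b * unip (algebraMap (𝓞 K) K c) =
      monomialRep a (x + algebraMap (𝓞 K) K c / algebraMap (𝓞 K) K b) b := by
  rw [monomialRep, monomialRep, ← unip_mul_unip, ← diag_mul_unip_mul_inv]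
  group

end MonomialRep

section Monomials

variable {K A : Type*} [Field K] [NumberField K] [Ring A] [StarRing A]
  (m : (𝓞 K)⁰ → A) (t : KModO K → A)

/-- The monomial `m_a^* t_x m_b` of the matrix `p = monomialRep a x b`. The triple `(a, x, b)` is
chosen; under the defining relations the choice does not matter, by
`Relations.monomialAt_monomialRep`. -/
noncomputable def monomialAt (p : PK K) : A :=
  star (m (exists_monomialRep_eq p).choose) *
    t (cls K (exists_monomialRep_eq p).choose_spec.choose) *
      m (exists_monomialRep_eq p).choose_spec.choose_spec.choose

theorem exists_monomialAt_eq (p : PK K) : ∃ a x b, monomialRep a x b = p ∧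
    monomialAt m t p = star (m a) * t (cls K x) * m b :=
  ⟨_, _, _, (exists_monomialRep_eq p).choose_spec.choose_spec.choose_spec, rfl⟩

/-- The set of monomials `m_a^* t_r m_b` of an arbitrary pair of families. -/
def monomialsOf : Set A := {f | ∃ (a b : (𝓞 K)⁰) (r : KModO K), f = star (m a) * t r * m b}

end Monomials

theorem mul_mem_of_mem_span {R A : Type*} [CommSemiring R] [Semiring A] [Algebra R A] {S : Set A}
    {W : Submodule R A} {z f : A} (hS : ∀ f ∈ S, f * z ∈ W) (hf : f ∈ Submodule.span R S) :
    f * z ∈ W :=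
  (Submodule.span_le (p := W.comap (LinearMap.mulRight R z))).2 hS hf

namespace Relations

variable {K A : Type*} [Field K] [NumberField K] [Ring A] [StarRing A] [Algebra ℂ A]
  {m : (𝓞 K)⁰ → A} {t : KModO K → A} (h : Relations m t)
include h

theorem star_mu_mul_theta_mul_mu_congr {a b a' b' : (𝓞 K)⁰} {x x' : K}
    (hp : monomialRep a x b = monomialRep a' x' b') :
    star (m a) * t (cls K x) * m b = star (m a') * t (cls K x') * m b' := by
  obtain ⟨hab, hx⟩ := monomialRep_eq_iff.1 hp
  have hb : algebraMap (𝓞 K) K b ≠ 0 := by simp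
  have hb' : algebraMap (𝓞 K) K b' ≠ 0 := by simp
  calc
    _ = star (m (b' * a)) * t (cls K (x / algebraMap (𝓞 K) K b')) * m (b' * b) := by
      rw [h.star_mu_mul_theta_mul_mu_mul, mul_div_cancel₀ _ hb']
    _ = star (m (b * a')) * t (cls K (x' / algebraMap (𝓞 K) K b)) * m (b * b') := by
      rw [← hab, mul_comm b' b, (div_eq_div_iff hb' hb).2 hx]
    _ = _ := by rw [h.star_mu_mul_theta_mul_mu_mul, mul_div_cancel₀ _ hb]

theorem monomialAt_monomialRep (a : (𝓞 K)⁰) (x : K) (b : (𝓞 K)⁰) :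
    monomialAt m t (monomialRep a x b) = star (m a) * t (cls K x) * m b := by
  obtain ⟨a', x', b', hp, heq⟩ := exists_monomialAt_eq m t (monomialRep a x b)
  rw [heq, h.star_mu_mul_theta_mul_mu_congr hp]

theorem monomialAt_dil_mul (u : (𝓞 K)ˣ) (p : PK K) :
    monomialAt m t (dil (unitOfInt u) * p) = monomialAt m t p := by
  obtain ⟨a, x, b, rfl⟩ := exists_monomialRep_eq p
  obtain ⟨y, rfl⟩ : ∃ y, algebraMap (𝓞 K) K u * y = x :=
    ⟨_, Units.mul_inv_cancel_left (unitOfInt u) x⟩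
  rw [dil_mul_monomialRep, h.monomialAt_monomialRep, h.monomialAt_monomialRep,
    h.mu_nonzeroOfUnit_mul, ← units_smul_cls, h.theta_smul]

theorem monomialAt_unip_mul (c : 𝓞 K) (p : PK K) :
    monomialAt m t (unip (algebraMap (𝓞 K) K c) * p) = monomialAt m t p := by
  obtain ⟨a, x, b, rfl⟩ := exists_monomialRep_eq p
  rw [unip_mul_monomialRep, h.monomialAt_monomialRep, h.monomialAt_monomialRep,
    h.star_mu_mul_theta_add_div]

theorem monomialAt_mul_dil (p : PK K) (u : (𝓞 K)ˣ) :
    monomialAt m t (p * dil (unitOfInt u)) = monomialAt m t p := by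
  obtain ⟨a, x, b, rfl⟩ := exists_monomialRep_eq p
  rw [monomialRep_mul_dil, h.monomialAt_monomialRep, h.monomialAt_monomialRep,
    h.mu_nonzeroOfUnit_mul]

theorem monomialAt_mul_unip (p : PK K) (c : 𝓞 K) :
    monomialAt m t (p * unip (algebraMap (𝓞 K) K c)) = monomialAt m t p := by
  obtain ⟨a, x, b, rfl⟩ := exists_monomialRep_eq p
  rw [monomialRep_mul_unip, h.monomialAt_monomialRep, h.monomialAt_monomialRep, mul_assoc,
    h.theta_add_div_mul_mu, mul_assoc]

theorem monomialAt_congr {p q : PK K} (hq : q ∈ DoubleCoset.doubleCoset p (PO K) (PO K)) :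
    monomialAt m t q = monomialAt m t p := by
  obtain ⟨k, hk, k', hk', rfl⟩ := DoubleCoset.mem_doubleCoset.1 hq
  obtain ⟨u, c, rfl⟩ := exists_eq_dil_mul_unip hk
  obtain ⟨v, d, rfl⟩ := exists_eq_dil_mul_unip hk'
  rw [← mul_assoc, h.monomialAt_mul_unip, h.monomialAt_mul_dil, mul_assoc, h.monomialAt_dil_mul,
    h.monomialAt_unip_mul]

theorem range_monomialAt : Set.range (monomialAt m t) = monomialsOf m t := by
  refine Set.Subset.antisymm ?_ ?_
  · rintro _ ⟨p, rfl⟩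
    obtain ⟨a, x, b, -, heq⟩ := exists_monomialAt_eq m t p
    exact ⟨a, b, cls K x, heq⟩
  · rintro _ ⟨a, b, r, rfl⟩
    obtain ⟨x, rfl⟩ := cls_surjective r
    exact ⟨monomialRep a x b, h.monomialAt_monomialRep a x b⟩

theorem monomialAt_out_mk (p : PK K) :
    monomialAt m t (DoubleCoset.mk (PO K) (PO K) p).out = monomialAt m t p := by
  obtain ⟨k, k', hk, hk', hout⟩ := DoubleCoset.mk_out_eq_mul (PO K) (PO K) p
  exact h.monomialAt_congr (DoubleCoset.mem_doubleCoset.2 ⟨k, hk, k', hk', hout⟩)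

theorem mul_mu_mem_span {f : A} (hf : f ∈ Submodule.span ℂ (monomialsOf m t)) (d : (𝓞 K)⁰) :
    f * m d ∈ Submodule.span ℂ (monomialsOf m t) := by
  refine mul_mem_of_mem_span ?_ hf
  rintro _ ⟨a, b, r, rfl⟩
  refine Submodule.subset_span ⟨a, b * d, r, ?_⟩
  rw [mul_assoc, h.mu_mul]

theorem mul_theta_mem_span {f : A} (hf : f ∈ Submodule.span ℂ (monomialsOf m t)) (s : KModO K) :
    f * t s ∈ Submodule.span ℂ (monomialsOf m t) := by
  refine mul_mem_of_mem_span ?_ hf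
  rintro _ ⟨a, b, r, rfl⟩
  obtain ⟨y, rfl⟩ := cls_surjective s
  have hb : algebraMap (𝓞 K) K b ≠ 0 := by simp
  have hcomm : star (m a) * t r * m b * t (cls K y) =
      star (m a) * (t r * t (cls K (y / algebraMap (𝓞 K) K b))) * m b := by
    simp only [mul_assoc, h.theta_mul_mu, mul_div_cancel₀ _ hb]
  rw [hcomm, h.theta_mul_theta_eq_average, mul_smul_comm, smul_mul_assoc, Finset.mul_sum,
    Finset.sum_mul]
  exact Submodule.smul_mem _ _ (Submodule.sum_mem _ fun v _ => Submodule.subset_span ⟨a, b, _, rfl⟩)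

theorem mul_star_mu_mem_span {f : A} (hf : f ∈ Submodule.span ℂ (monomialsOf m t)) (c : (𝓞 K)⁰) :
    f * star (m c) ∈ Submodule.span ℂ (monomialsOf m t) := by
  refine mul_mem_of_mem_span ?_ hf
  rintro _ ⟨a, b, r, rfl⟩
  obtain ⟨x, rfl⟩ := cls_surjective r
  have hc : algebraMap (𝓞 K) K c ≠ 0 := by simp
  have hcomm : star (m a) * t (cls K x) * m b * star (m c) =
      star (m (c * a)) * t (cls K (x / algebraMap (𝓞 K) K c)) * m b * (m c * star (m c)) := by
    rw [← mul_assoc, mul_assoc _ (m b) (m c), h.mu_mul, mul_comm b,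
      h.star_mu_mul_theta_mul_mu_mul, mul_div_cancel₀ _ hc]
  rw [hcomm, h.mu_mul_star_mu, mul_smul_comm, Finset.mul_sum]
  exact Submodule.smul_mem _ _ (Submodule.sum_mem _ fun d _ =>
    h.mul_theta_mem_span (Submodule.subset_span ⟨c * a, b, _, rfl⟩) _)

theorem mul_mem_span {f g : A} (hf : f ∈ Submodule.span ℂ (monomialsOf m t))
    (hg : g ∈ Submodule.span ℂ (monomialsOf m t)) :
    f * g ∈ Submodule.span ℂ (monomialsOf m t) := by
  refine (Submodule.span_le (p := (Submodule.span ℂ (monomialsOf m t)).comap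
    (LinearMap.mulLeft ℂ f))).2 ?_ hg
  rintro _ ⟨c, d, s, rfl⟩
  change f * (star (m c) * t s * m d) ∈ Submodule.span ℂ _
  rw [← mul_assoc, ← mul_assoc]
  exact h.mul_mu_mem_span (h.mul_theta_mem_span (h.mul_star_mu_mem_span hf c) s) d

end Relations

/-! ### The basis of monomials and the universal property -/

section MonomialBasis

variable {K : Type*} [Field K] [NumberField K]

theorem star_mu_mul_theta_mul_mu (a : (𝓞 K)⁰) (x : K) (b : (𝓞 K)⁰) :
    star (mu a) * theta (cls K x) * mu b =
      (1 / sqrtN a * sqrtN b) • normalizedElem (PO K) (monomialRep a x b) := by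
  rw [star_mu_eq_smul_normalizedElem, mu_eq_smul_normalizedElem, mul_assoc, mul_smul_comm,
    smul_mul_smul_comm, diag_eq_dil b, theta_mul_normalizedElem_dil, normalizedElem_inv_diag_mul,
    ← mul_assoc]
  rfl

theorem exists_monomialAt_eq_smul_doubleCosetElem (p : PK K) :
    ∃ c : ℂˣ, monomialAt mu theta p = c • doubleCosetElem (PO K) p := by
  obtain ⟨a, x, b, rfl⟩ := exists_monomialRep_eq p
  have hsqrt : 1 / sqrtN a * sqrtN b ≠ 0 :=
    mul_ne_zero (one_div_ne_zero (sqrtN_ne_zero a)) (sqrtN_ne_zero b)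
  have hcard : (1 / numRightCosets (PO K) (monomialRep a x b) : ℂ) ≠ 0 :=
    one_div_ne_zero (Nat.cast_ne_zero.2 (numRightCosets_ne_zero _))
  refine ⟨.mk0 _ (mul_ne_zero hsqrt hcard), ?_⟩
  rw [relations_mu_theta.monomialAt_monomialRep, star_mu_mul_theta_mul_mu, normalizedElem,
    smul_smul, Units.smul_mk0]

variable (K) in
/-- The basis of the Hecke algebra that consists of the monomials `μ_a^* θ_r μ_b`, indexed by the
double cosets that support them. -/
noncomputable def monomialBasis :
    Module.Basis (DoubleCoset.Quotient (PO K : Set (PK K)) (PO K)) ℂ (HeckeAlgebra (PO K)) :=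
  (doubleCosetBasis (PO K)).unitsSMul fun D =>
    (exists_monomialAt_eq_smul_doubleCosetElem D.out).choose

theorem monomialBasis_apply (D : DoubleCoset.Quotient (PO K : Set (PK K)) (PO K)) :
    monomialBasis K D = monomialAt mu theta D.out := by
  rw [monomialBasis, Module.Basis.unitsSMul_apply, doubleCosetBasis_apply,
    ← (exists_monomialAt_eq_smul_doubleCosetElem D.out).choose_spec]

theorem range_monomialBasis : Set.range (monomialBasis K) = monomials K := by
  refine Set.Subset.antisymm ?_ ?_
  · rintro _ ⟨D, rfl⟩
    rw [monomialBasis_apply]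
    exact relations_mu_theta.range_monomialAt.subset ⟨D.out, rfl⟩
  · intro f hf
    obtain ⟨p, rfl⟩ := relations_mu_theta.range_monomialAt.superset hf
    exact ⟨DoubleCoset.mk (PO K) (PO K) p,
      (monomialBasis_apply _).trans (relations_mu_theta.monomialAt_out_mk p)⟩

theorem linearIndependent_monomials :
    LinearIndependent ℂ (Subtype.val : monomials K → HeckeAlgebra (PO K)) := by
  rw [← range_monomialBasis]
  exact (monomialBasis K).linearIndependent.linearIndepOn_id

theorem span_monomials : Submodule.span ℂ (monomials K) = ⊤ := by
  rw [← range_monomialBasis, (monomialBasis K).span_eq]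

end MonomialBasis

section Universal

variable {K A : Type*} [Field K] [NumberField K] [Ring A] [StarRing A] [Algebra ℂ A]

/-- The linear map from the Hecke algebra that sends `μ_a^* θ_r μ_b` to `m_a^* t_r m_b`, when `m`
and `t` satisfy the defining relations. -/
noncomputable def liftₗ (m : (𝓞 K)⁰ → A) (t : KModO K → A) : HeckeAlgebra (PO K) →ₗ[ℂ] A :=
  (monomialBasis K).constr ℂ fun D => monomialAt m t D.out

namespace Relations

variable {m : (𝓞 K)⁰ → A} {t : KModO K → A} (h : Relations m t)
include h

theorem liftₗ_monomial (a b : (𝓞 K)⁰) (r : KModO K) :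
    liftₗ m t (star (mu a) * theta r * mu b) = star (m a) * t r * m b := by
  obtain ⟨x, rfl⟩ := cls_surjective r
  rw [← relations_mu_theta.monomialAt_monomialRep, ← h.monomialAt_monomialRep,
    ← relations_mu_theta.monomialAt_out_mk, ← h.monomialAt_out_mk, ← monomialBasis_apply, liftₗ,
    Module.Basis.constr_basis]

theorem liftₗ_mu (a : (𝓞 K)⁰) : liftₗ m t (mu a) = m a := by
  simpa only [relations_mu_theta.mu_one, h.mu_one, relations_mu_theta.theta_zero, h.theta_zero,
    star_one, one_mul] using h.liftₗ_monomial 1 a 0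

theorem liftₗ_theta (r : KModO K) : liftₗ m t (theta r) = t r := by
  simpa only [relations_mu_theta.mu_one, h.mu_one, star_one, one_mul, mul_one] using
    h.liftₗ_monomial 1 1 r

theorem liftₗ_one : liftₗ m t 1 = 1 := by
  rw [← relations_mu_theta.theta_zero, h.liftₗ_theta, h.theta_zero]

theorem prod {B : Type*} [Ring B] [StarRing B] [Algebra ℂ B] {m' : (𝓞 K)⁰ → B}
    {t' : KModO K → B} (h' : Relations m' t') :
    Relations (fun a => (m a, m' a)) (fun r => (t r, t' r)) where
  mu_unit a ha := Prod.ext (h.mu_unit a ha) (h'.mu_unit a ha)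
  star_mu_mul_mu a := Prod.ext (h.star_mu_mul_mu a) (h'.star_mu_mul_mu a)
  mu_mul a b := Prod.ext (h.mu_mul a b) (h'.mu_mul a b)
  theta_zero := Prod.ext h.theta_zero h'.theta_zero
  theta_smul r w := Prod.ext (h.theta_smul r w) (h'.theta_smul r w)
  star_theta r := Prod.ext (h.star_theta r) (h'.star_theta r)
  theta_mul r s := Prod.ext
    (by simpa only [Prod.fst_mul, Prod.smul_fst, Prod.fst_sum] using h.theta_mul r s)
    (by simpa only [Prod.snd_mul, Prod.smul_snd, Prod.snd_sum] using h'.theta_mul r s)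
  mu_theta_star_mu a x := Prod.ext
    (by simpa only [Prod.fst_mul, Prod.fst_star, Prod.smul_fst, Prod.fst_sum] using
      h.mu_theta_star_mu a x)
    (by simpa only [Prod.snd_mul, Prod.snd_star, Prod.smul_snd, Prod.snd_sum] using
      h'.mu_theta_star_mu a x)

theorem graph_liftₗ : (liftₗ m t).graph =
    Submodule.span ℂ (monomialsOf (fun a => (mu a, m a)) fun r => (theta r, t r)) := by
  have himage : LinearMap.id.prod (liftₗ m t) '' monomials K =
      monomialsOf (fun a => (mu a, m a)) fun r => (theta r, t r) := by
    ext f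
    constructor
    · rintro ⟨_, ⟨a, b, r, rfl⟩, rfl⟩
      exact ⟨a, b, r, Prod.ext rfl (h.liftₗ_monomial a b r)⟩
    · rintro ⟨a, b, r, rfl⟩
      exact ⟨_, ⟨a, b, r, rfl⟩, Prod.ext rfl (h.liftₗ_monomial a b r)⟩
  rw [LinearMap.graph_eq_range_prod, LinearMap.range_eq_map, ← span_monomials, Submodule.map_span,
    himage]

theorem liftₗ_mul (f g : HeckeAlgebra (PO K)) :
    liftₗ m t (f * g) = liftₗ m t f * liftₗ m t g := by
  have hmem (f : HeckeAlgebra (PO K)) : (f, liftₗ m t f) ∈ (liftₗ m t).graph := rfl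
  have hmul := (relations_mu_theta.prod h).mul_mem_span (h.graph_liftₗ ▸ hmem f)
    (h.graph_liftₗ ▸ hmem g)
  rw [← h.graph_liftₗ] at hmul
  exact hmul.symm

theorem star_monomial (a b : (𝓞 K)⁰) (r : KModO K) :
    star (star (m a) * t r * m b) = star (m b) * t r * m a := by
  rw [star_mul, star_mul, star_star, h.star_theta, mul_assoc]

theorem liftₗ_star [StarModule ℂ A] (f : HeckeAlgebra (PO K)) :
    liftₗ m t (star f) = star (liftₗ m t f) := by
  have heq : (liftₗ m t).comp (starLinearEquiv ℂ).toLinearMap =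
      (starLinearEquiv ℂ).toLinearMap.comp (liftₗ m t) := by
    refine LinearMap.ext_on span_monomials ?_
    rintro _ ⟨a, b, r, rfl⟩
    simp only [LinearMap.comp_apply, LinearEquiv.coe_coe, starLinearEquiv_apply]
    rw [relations_mu_theta.star_monomial, h.liftₗ_monomial, h.liftₗ_monomial, h.star_monomial]
  exact LinearMap.congr_fun heq f

/-- The `*`-homomorphism from the Hecke algebra determined by a solution of the relations. -/
noncomputable def lift [StarModule ℂ A] : HeckeAlgebra (PO K) →⋆ₐ[ℂ] A :=
  { AlgHom.ofLinearMap (liftₗ m t) h.liftₗ_one h.liftₗ_mul with map_star' := h.liftₗ_star }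

end Relations

theorem starAlgHom_ext {φ ψ : HeckeAlgebra (PO K) →⋆ₐ[ℂ] A}
    (hmu : ∀ a, φ (mu a) = ψ (mu a)) (htheta : ∀ r, φ (theta r) = ψ (theta r)) : φ = ψ := by
  have heq : (φ : HeckeAlgebra (PO K) →ₗ[ℂ] A) = (ψ : HeckeAlgebra (PO K) →ₗ[ℂ] A) := by
    refine LinearMap.ext_on span_monomials ?_
    rintro _ ⟨a, b, r, rfl⟩
    simp [map_mul, map_star, hmu, htheta]
  exact StarAlgHom.ext (LinearMap.congr_fun heq)

end Universal

end NFHecke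

theorem mainTheorem7 (K : Type v) [Field K] [NumberField K] :
    NFHecke.Relations (K := K) NFHecke.mu NFHecke.theta ∧
    (∀ (A : Type w) [Ring A] [StarRing A] [Algebra ℂ A] [StarModule ℂ A]
      (m : nonZeroDivisors (𝓞 K) → A) (t : NFHecke.KModO K → A), NFHecke.Relations m t →
      ∃! φ : HeckePair.HeckeAlgebra (NFHecke.PO K) →⋆ₐ[ℂ] A,
        (∀ a, φ (NFHecke.mu a) = m a) ∧ ∀ r, φ (NFHecke.theta r) = t r) ∧
    LinearIndependent ℂ
      (Subtype.val : NFHecke.monomials K → HeckePair.HeckeAlgebra (NFHecke.PO K)) ∧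
    Submodule.span ℂ (NFHecke.monomials K) = ⊤ := by
  refine ⟨NFHecke.relations_mu_theta, fun A _ _ _ _ m t h =>
    ⟨h.lift, ⟨h.liftₗ_mu, h.liftₗ_theta⟩, fun ψ hψ => ?_⟩,
    NFHecke.linearIndependent_monomials, NFHecke.span_monomials⟩
  exact NFHecke.starAlgHom_ext (fun a => (hψ.1 a).trans (h.liftₗ_mu a).symm)
    fun r => (hψ.2 r).trans (h.liftₗ_theta r).symm
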